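/- Let $d\ge 1$. A weight on $\mathbb{R}^d$ is a measurable function that is positive and finite almost everywhere; write $v(E)=\int_E v\,dx$. Cubes $Q$ are half-open with sides parallel to the axes, with center $c_Q$ and side length $\ell(Q)$; $\langle g\rangle_Q=\frac1{|Q|}\int_Q g\,dx$, $\langle g\rangle_{1,Q}=\langle |g|\rangle_Q$, $\langle g\rangle_{\infty,Q}=\operatorname{ess\,sup}_Q|g|$, and $Mg=\sup_Q\langle g\rangle_{1,Q}\mathbf 1_Q$. Suprema below are over all cubes. For weights $v,w$ and measurable $g$ put $$[v]_{A_1}=\sup_Q\langle v\rangle_{1,Q}\langle v^{-1}\rangle_{\infty,Q},\qquad [v]_{A_\infty}=\sup_Q\frac1{v(Q)}\int_Q M(\mathbf 1_Q v)\,dx,$$ $$\|g\|_{\mathrm{BMO}^1_w}=\sup_Q\frac{\langle g-\langle g\rangle_Q\rangle_{1,Q}}{\langle w^{-1}\rangle_{1,Q}},\qquad \|g\|_{\mathrm{BMO}^\infty_w}=\sup_Q\langle w\rangle_{\infty,Q}\langle g-\langle g\rangle_Q\rangle_{1,Q}$$ (a supremum is $\infty$ if $g$ is not integrable on some cube). Let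 $\Omega:[0,\infty)\to[0,\infty)$ be increasing and subadditive with $\Omega(0)=0$ and $\Omega\not\equiv0$ (equivalently, $\Omega(1)>0$), and put $$\|\Omega\|_{\mathrm{Dini}}=\int_0^1\Omega(t)\frac{dt}t,\qquad [v]_{B(\Omega)}=\sup_Q\frac{|Q|}{v(Q)}\int_{Q^c}\frac{v(x)}{|x-c_Q|^d}\,\Omega\Bigl(\frac{\ell(Q)}{|x-c_Q|}\Bigr)dx .$$ All of these quantities take values in $[0,\infty]$, with $0\cdot\infty=0$. There is a constant $C$ depending only on $d$ with the following property. Let $T$ be a linear operator from $L^1(\mathbb{R}^d)$ to the (real-valued) measurable functions that is of weak type $(1,1)$ with bound $A<\infty$, that is, $t\,|\{|Tf|>t\}|\le A\|f\|_{L^1}$ for all $t>0$ and $f\in L^1(\mathbb{R}^d)$. Suppose that there is a kernel $K$ such that $Tf(x)=\int K(x,y)f(y)\,dy$, with an absolutely convergent integral, for almost every $x\notin\operatorname{supp}f$, for every $f\in L^1(\mathbb{R}^d)$ with compact support, and such that $$|K(x,y)-K(z,y)|\le\Omega\Bigl(\frac{|x-z|}{|x-y|}\Bigr)\frac1{|x-y|^d}\qquad\text{whenever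 } |x-y|>2|x-z|>0 .$$ Let $w$ be a weight with $w^{-1}\in L^1_{\mathrm{loc}}(\mathbb{R}^d)$, and let $f$ be a measurable function with compact support and $fw\in L^\infty(\mathbb{R}^d)$. Then $f\in L^1(\mathbb{R}^d)$, and $$\|Tf\|_{\mathrm{BMO}^1_w}\le C\Bigl(1+\frac{A}{\Omega(1)}\Bigr)\bigl([1]_{B(\Omega)}+[w^{-1}]_{B(\Omega)}\bigr)[w^{-1}]_{A_\infty}\|fw\|_{L^\infty},$$ $$\|Tf\|_{\mathrm{BMO}^\infty_w}\le C\Bigl(1+\frac{A}{\Omega(1)}\Bigr)[w^{-1}]_{A_1}^2[w^{-1}]_{A_\infty}\|\Omega\|_{\mathrm{Dini}}\|fw\|_{L^\infty}.$$ -/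

import Mathlib

open MeasureTheory Set
open scoped NNReal ENNReal

noncomputable section

namespace WeightedBMO

/-- `ℝ^d` with the Euclidean norm; `volume` is Lebesgue measure. -/
abbrev Space (d : ℕ) : Type := EuclideanSpace ℝ (Fin d)

/-- A cube with sides parallel to the axes, given by its lower corner and its side length. -/
structure Cube (d : ℕ) where
  corner : Space d
  side : ℝ
  side_pos : 0 < side

/-- The half-open cube `∏ᵢ [aᵢ, aᵢ + ℓ)` as a set. -/
def Cube.toSet {d : ℕ} (Q : Cube d) : Set (Space d) :=
  {x | ∀ i, Q.corner i ≤ x i ∧ x i < Q.corner i + Q.side}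

/-- The center `c_Q`. -/
def Cube.center {d : ℕ} (Q : Cube d) : Space d :=
  WithLp.toLp 2 (fun i => Q.corner i + Q.side / 2)

/-- A weight: a measurable function that is positive (and finite) almost everywhere. -/
structure IsWeight {d : ℕ} (w : Space d → ℝ) : Prop where
  aemeasurable : AEMeasurable w volume
  pos : ∀ᵐ x, 0 < w x

/-- `v(E) = ∫_E v dx` for a weight `v`. -/
def mass {d : ℕ} (v : Space d → ℝ) (E : Set (Space d)) : ℝ≥0∞ :=
  ∫⁻ x in E, ENNReal.ofReal (v x)

/-- `⟨g⟩_{1,Q} = |Q|⁻¹ ∫_Q |g| dx`. -/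
def avgAbs {d : ℕ} (g : Space d → ℝ) (Q : Cube d) : ℝ≥0∞ :=
  (∫⁻ x in Q.toSet, ‖g x‖ₑ) / volume Q.toSet

/-- `⟨g⟩_{∞,Q}`, the essential supremum of `|g|` on `Q`. -/
def essSupOn {d : ℕ} (g : Space d → ℝ) (Q : Cube d) : ℝ≥0∞ :=
  eLpNorm g ∞ (volume.restrict Q.toSet)

/-- The mean oscillation `⟨g - ⟨g⟩_Q⟩_{1,Q}`. For a measurable `g` that is not integrable on `Q`
the Bochner average is `0`, and the value of the oscillation is then `∞`. -/
def osc {d : ℕ} (g : Space d → ℝ) (Q : Cube d) : ℝ≥0∞ :=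
  avgAbs (fun x => g x - ⨍ y in Q.toSet, g y) Q

/-- `‖g‖_{BMO^1_w} = sup_Q ⟨g - ⟨g⟩_Q⟩_{1,Q} / ⟨w⁻¹⟩_{1,Q}`. -/
def bmoOne {d : ℕ} (w g : Space d → ℝ) : ℝ≥0∞ :=
  ⨆ Q : Cube d, osc g Q / avgAbs (fun x => (w x)⁻¹) Q

/-- `‖g‖_{BMO^∞_w} = sup_Q ⟨w⟩_{∞,Q} ⟨g - ⟨g⟩_Q⟩_{1,Q}`. -/
def bmoInfty {d : ℕ} (w g : Space d → ℝ) : ℝ≥0∞ :=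
  ⨆ Q : Cube d, essSupOn w Q * osc g Q

/-- The Hardy-Littlewood maximal function over all cubes. -/
def maximal {d : ℕ} (g : Space d → ℝ) (x : Space d) : ℝ≥0∞ :=
  ⨆ (Q : Cube d) (_ : x ∈ Q.toSet), avgAbs g Q

/-- The Muckenhoupt constant `[v]_{A_1} = sup_Q ⟨v⟩_{1,Q} ⟨v⁻¹⟩_{∞,Q}`. -/
def aOneConst {d : ℕ} (v : Space d → ℝ) : ℝ≥0∞ :=
  ⨆ Q : Cube d, avgAbs v Q * essSupOn (fun x => (v x)⁻¹) Q

/-- The Fujii-Wilson constant `[v]_{A_∞} = sup_Q v(Q)⁻¹ ∫_Q M(1_Q v) dx`. -/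
def aInftyConst {d : ℕ} (v : Space d → ℝ) : ℝ≥0∞ :=
  ⨆ Q : Cube d, (∫⁻ x in Q.toSet, maximal (Q.toSet.indicator v) x) / mass v Q.toSet

/-- `[v]_{B(Ω)} = sup_Q |Q| / v(Q) ∫_{Q^c} v(x) |x - c_Q|^{-d} Ω(ℓ(Q) / |x - c_Q|) dx`. -/
def bConst {d : ℕ} (Ω : ℝ≥0 → ℝ≥0) (v : Space d → ℝ) : ℝ≥0∞ :=
  ⨆ Q : Cube d, volume Q.toSet / mass v Q.toSet *
    ∫⁻ x in Q.toSetᶜ, ENNReal.ofReal (v x / ‖x - Q.center‖ ^ d) *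
      (Ω (Q.side / ‖x - Q.center‖).toNNReal : ℝ≥0∞)

/-- `‖Ω‖_Dini = ∫_0^1 Ω(t) dt / t`. -/
def diniNorm (Ω : ℝ≥0 → ℝ≥0) : ℝ≥0∞ :=
  ∫⁻ t in Ioc (0 : ℝ) 1, (Ω t.toNNReal : ℝ≥0∞) / ENNReal.ofReal t

/-- An increasing subadditive function `Ω : [0,∞) → [0,∞)` with `Ω(0) = 0`. -/
structure IsModulus (Ω : ℝ≥0 → ℝ≥0) : Prop where
  mono : Monotone Ω
  subadd : ∀ s t, Ω (s + t) ≤ Ω s + Ω t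
  zero : Ω 0 = 0

/-- The kernel `K` is `Ω`-smooth in its first variable. -/
def IsSmoothKernel {d : ℕ} (Ω : ℝ≥0 → ℝ≥0) (K : Space d → Space d → ℝ) : Prop :=
  ∀ x y z : Space d, 0 < 2 * ‖x - z‖ → 2 * ‖x - z‖ < ‖x - y‖ →
    |K x y - K z y| ≤ (Ω (‖x - z‖ / ‖x - y‖).toNNReal : ℝ) * (1 / ‖x - y‖ ^ d)

/-- The linear operators from `L^1(ℝ^d)` to the space `L^0(ℝ^d)` of (classes of) measurable
functions. -/
abbrev Operator (d : ℕ) : Type :=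
  (Lp ℝ 1 (volume : Measure (Space d))) →ₗ[ℝ] (Space d →ₘ[(volume : Measure (Space d))] ℝ)

/-- `T` is of weak type `(1,1)` with bound `A`: `t |{|Tf| > t}| ≤ A ‖f‖_1` for all `t > 0`. -/
def IsWeakType {d : ℕ} (T : Operator d) (A : ℝ≥0) : Prop :=
  ∀ (f : Lp ℝ 1 (volume : Measure (Space d))) (t : ℝ≥0), 0 < t →
    (t : ℝ≥0∞) * volume {x | (t : ℝ≥0∞) < ‖T f x‖ₑ} ≤ A * ‖f‖ₑ

/-- `Tf(x) = ∫ K(x,y) f(y) dy`, as a convergent integral, for almost every `x ∉ supp f` and for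
all integrable `f` with compact support. -/
def IsRepresentedBy {d : ℕ} (T : Operator d) (K : Space d → Space d → ℝ) : Prop :=
  ∀ (f : Space d → ℝ) (hf : Integrable f volume), HasCompactSupport f →
    ∀ᵐ x, x ∉ tsupport f →
      Integrable (fun y => K x y * f y) volume ∧ T (hf.toL1 f) x = ∫ y, K x y * f y

end WeightedBMO

end

open MeasureTheory Set
open scoped NNReal ENNReal

noncomputable section

namespace WeightedBMO

variable {d : ℕ}

/-! ### Dyadic subcubes and the Calderón–Zygmund selection. -/

namespace Cube

/-! Put `v = w⁻¹` and `N = ‖fw‖_∞`, so that `|f| ≤ N v` almost everywhere. The proof turns a weak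
local estimate on every cube into a strong one, at the cost of a maximal function.

Local estimate (`exists_const_volume_le`): with `D` comparable to `(1 + A/Ω(1)) ([1]_B + [v]_B) N`,
each cube `Q` has a constant `c_Q` such that `|Tf - c_Q| ≤ D ⟨v⟩_Q` on `Q` outside a set of measure
at most `2^{-(d+3)} |Q|`. Split `f` at a ball `B` around `Q` of comparable size. The far part has an
almost constant image on `Q`: kernel smoothness bounds its oscillation by the integral that defines
`[v]_B`. The near part is handled by the weak type bound and `‖f 1_B‖₁ ≤ N v(B)`. The needed
doubling `Ω(1) v(B) ≲ ([1]_B + [v]_B) v(Q)` also comes from `B(Ω)`: on `B \ Q` the factor `Ω(ℓ/|x -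
c_Q|)` is at least a multiple of `Ω(1)`, and on `Q` itself one uses `Ω(1) ≲ [1]_B`.

Self-improvement (`lintegral_sub_le_lintegral_maximal`): cover the exceptional set of `Q` by
disjoint subcubes filling at most half of `Q`, and iterate inside them. Each generation costs a
multiple of `D ⟨v⟩_Q |Q|`. Since the part of `Q` left uncovered has at least half its measure and
`M(1_Q v) ≥ ⟨v⟩_Q` there, the costs add up to `4D ∫_Q M(1_Q v) ≤ 4D [v]_{A_∞} v(Q)`. This is the
first estimate.

For the second, summing over dyadic annuli gives `[1]_B + [v]_B ≲ [v]_{A_1} ‖Ω‖_Dini`, and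
`⟨w⟩_{∞,Q} ⟨v⟩_Q ≤ [v]_{A_1}` compares the two BMO norms. Each step costs one factor `[v]_{A_1}`. -/

lemma toSet_eq_preimage (Q : Cube d) :
    Q.toSet = (WithLp.ofLp : Space d → Fin d → ℝ) ⁻¹'
      univ.pi fun i => Ico (Q.corner i) (Q.corner i + Q.side) := by
  ext x
  simp [toSet, Set.mem_pi]

lemma measurableSet_toSet (Q : Cube d) : MeasurableSet Q.toSet := by
  rw [toSet_eq_preimage]
  exact (PiLp.volume_preserving_ofLp (Fin d)).measurable
    (MeasurableSet.univ_pi fun _ => measurableSet_Ico)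

lemma volume_toSet (Q : Cube d) : volume Q.toSet = ENNReal.ofReal Q.side ^ d := by
  rw [toSet_eq_preimage, (PiLp.volume_preserving_ofLp (Fin d)).measure_preimage
    (MeasurableSet.univ_pi fun _ => measurableSet_Ico).nullMeasurableSet, Real.volume_pi_Ico]
  simp

lemma volume_toSet_ne_zero (Q : Cube d) : volume Q.toSet ≠ 0 := by
  rw [volume_toSet]
  exact pow_ne_zero _ (by simpa using Q.side_pos)

lemma volume_toSet_ne_top (Q : Cube d) : volume Q.toSet ≠ ∞ := by
  rw [volume_toSet]
  exact ENNReal.pow_ne_top ENNReal.ofReal_ne_top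

lemma norm_le_of_abs_apply_le {x : Space d} {r : ℝ} (hr : 0 ≤ r) (h : ∀ i, |x i| ≤ r) :
    ‖x‖ ≤ d * r := by
  rw [EuclideanSpace.norm_eq]
  refine (Real.sqrt_le_left (by positivity)).2 ?_
  calc ∑ i, ‖x i‖ ^ 2 ≤ ∑ _i : Fin d, r ^ 2 :=
        Finset.sum_le_sum fun i _ => pow_le_pow_left₀ (norm_nonneg _) (h i) 2
    _ = d * r ^ 2 := by simp
    _ ≤ (d * r) ^ 2 := by
        rw [mul_pow]
        refine mul_le_mul_of_nonneg_right ?_ (sq_nonneg r)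
        exact_mod_cast Nat.le_self_pow two_ne_zero d

lemma norm_sub_le {Q : Cube d} {x z : Space d} (hx : x ∈ Q.toSet) (hz : z ∈ Q.toSet) :
    ‖x - z‖ ≤ d * Q.side :=
  norm_le_of_abs_apply_le Q.side_pos.le fun i => by
    have := hx i
    have := hz i
    rw [PiLp.sub_apply, abs_le]
    constructor <;> linarith

lemma center_mem (Q : Cube d) : Q.center ∈ Q.toSet := fun i => by
  have := Q.side_pos
  simp only [center]
  constructor <;> linarith

lemma le_norm_sub_center {Q : Cube d} {x : Space d} (hx : x ∉ Q.toSet) :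
    Q.side / 2 ≤ ‖x - Q.center‖ := by
  simp only [toSet, mem_ofPred_eq, not_forall] at hx
  obtain ⟨i, hi⟩ := hx
  refine le_trans ?_ (PiLp.norm_apply_le (x - Q.center) i)
  rw [Real.norm_eq_abs, le_abs, PiLp.sub_apply]
  simp only [center]
  by_contra! h
  exact hi ⟨by linarith [h.2], by linarith [h.1]⟩

/-- The dyadic descendant of `Q` of generation `n` with position `k`. -/
def descendant (Q : Cube d) (n : ℕ) (k : Fin d → ℤ) : Cube d where
  corner := WithLp.toLp 2 fun i => Q.corner i + k i * (Q.side / 2 ^ n)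
  side := Q.side / 2 ^ n
  side_pos := div_pos Q.side_pos (by positivity)

/-- The position of the dyadic cube of generation `n` that contains `x`. -/
def position (Q : Cube d) (n : ℕ) (x : Space d) : Fin d → ℤ :=
  fun i => ⌊(x i - Q.corner i) / (Q.side / 2 ^ n)⌋

lemma mem_descendant_iff {Q : Cube d} {n : ℕ} {k : Fin d → ℤ} {x : Space d} :
    x ∈ (Q.descendant n k).toSet ↔ Q.position n x = k := by
  have hs : 0 < Q.side / 2 ^ n := (Q.descendant n k).side_pos
  simp only [funext_iff, position, Int.floor_eq_iff, le_div_iff₀ hs, div_lt_iff₀ hs, toSet,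
    mem_ofPred_eq, descendant]
  refine forall_congr' fun i => and_congr ⟨fun h => by linarith, fun h => by linarith⟩
    ⟨fun h => by linarith, fun h => by linarith⟩

/-- Nestedness of the dyadic grid in terms of floors: `⌊t⌋ = ⌊⌊2t⌋ / 2⌋`. Consequently positions at
a fine generation determine those at all coarser ones. -/
lemma position_succ (Q : Cube d) (n : ℕ) (x : Space d) :
    Q.position n x = fun i => Q.position (n + 1) x i / 2 := by
  funext i
  have h := Int.floor_div_natCast ((x i - Q.corner i) / (Q.side / 2 ^ (n + 1))) 2
  simp only [position]
  rw [Nat.cast_ofNat] at h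
  rw [show ((2 : ℤ)) = ((2 : ℕ) : ℤ) from rfl, ← h]
  congr 1
  have := Q.side_pos
  push_cast
  field_simp
  ring

lemma position_eq_of_le {Q : Cube d} {x y : Space d} {m n : ℕ} (hmn : m ≤ n)
    (h : Q.position n x = Q.position n y) : Q.position m x = Q.position m y := by
  induction n, hmn using Nat.le_induction with
  | base => exact h
  | succ n _ ih =>
    refine ih ?_
    rw [position_succ Q n x, position_succ Q n y, h]

lemma descendant_zero_zero (Q : Cube d) : (Q.descendant 0 0).toSet = Q.toSet := by
  simp [descendant, toSet]

lemma mem_iff_position_zero {Q : Cube d} {x : Space d} : x ∈ Q.toSet ↔ Q.position 0 x = 0 := by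
  rw [← descendant_zero_zero, mem_descendant_iff]

lemma mem_descendant_position (Q : Cube d) (n : ℕ) (x : Space d) :
    x ∈ (Q.descendant n (Q.position n x)).toSet := mem_descendant_iff.2 rfl

lemma descendant_position_subset {Q : Cube d} {m n : ℕ} (hmn : m ≤ n) (x : Space d) :
    (Q.descendant n (Q.position n x)).toSet ⊆ (Q.descendant m (Q.position m x)).toSet :=
  fun _ hy => mem_descendant_iff.2 (position_eq_of_le hmn (mem_descendant_iff.1 hy))

lemma volume_descendant_succ (Q : Cube d) (n : ℕ) (k l : Fin d → ℤ) :
    volume (Q.descendant n k).toSet = 2 ^ d * volume (Q.descendant (n + 1) l).toSet := by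
  rw [volume_toSet, volume_toSet, ← mul_pow]
  congr 1
  rw [show (2 : ℝ≥0∞) = ENNReal.ofReal 2 by simp, ← ENNReal.ofReal_mul zero_le_two]
  congr 1
  simp only [descendant, pow_succ]
  field_simp

lemma exists_descendant_subset {Q : Cube d} {U : Set (Space d)} (hU : IsOpen U) {x : Space d}
    (hx : x ∈ U) : ∃ n, (Q.descendant n (Q.position n x)).toSet ⊆ U := by
  obtain ⟨ε, hε, hb⟩ := Metric.isOpen_iff.1 hU x hx
  have ht : Filter.Tendsto (fun n : ℕ => d * (Q.side / 2 ^ n)) Filter.atTop (nhds (d * 0)) := by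
    refine Filter.Tendsto.const_mul _ ?_
    exact tendsto_const_nhds.div_atTop (tendsto_pow_atTop_atTop_of_one_lt one_lt_two)
  rw [mul_zero] at ht
  obtain ⟨n, hn⟩ := (ht.eventually_lt_const hε).exists
  refine ⟨n, fun y hy => hb ?_⟩
  rw [Metric.mem_ball, dist_eq_norm]
  exact (norm_sub_le hy (mem_descendant_position Q n x)).trans_lt hn

/-- A Calderón–Zygmund selection: an open set `U` that is small in `Q` is covered inside `Q` by
disjoint subcubes of small total measure, each of which is at most half filled by `U`. -/
lemma exists_stopping_cubes (Q : Cube d) {U : Set (Space d)} (hU : IsOpen U)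
    (hUQ : volume U ≤ 2⁻¹ ^ (d + 2) * volume Q.toSet) :
    ∃ I : Set (Cube d), I.Countable ∧ I.PairwiseDisjoint Cube.toSet ∧
      (∀ P ∈ I, P.toSet ⊆ Q.toSet) ∧ U ∩ Q.toSet ⊆ ⋃ P ∈ I, P.toSet ∧
      volume (⋃ P ∈ I, P.toSet) ≤ 2⁻¹ * volume Q.toSet ∧
      ∀ P ∈ I, volume (P.toSet ∩ U) ≤ 2⁻¹ * volume P.toSet := by
  -- Select the first descendants in which `U` has density above `h`. The total measure of the
  -- selected cubes is at most `h⁻¹ |U| ≤ |Q| / 2`. The parent of a selected cube is not bad, so the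
  -- density in the cube itself is at most `2^d h = 1/2`.
  set h : ℝ≥0∞ := 2⁻¹ ^ (d + 1) with hh
  have h0 : h ≠ 0 := pow_ne_zero _ (by simp)
  have htop : h ≠ ∞ := ENNReal.pow_ne_top (by simp)
  let bad (n : ℕ) (x : Space d) : Prop :=
    h * volume (Q.descendant n (Q.position n x)).toSet <
      volume ((Q.descendant n (Q.position n x)).toSet ∩ U)
  have hbad0 : ∀ x ∈ Q.toSet, ¬ bad 0 x := by
    intro x hx
    simp only [bad, mem_iff_position_zero.1 hx, descendant_zero_zero, not_lt]
    calc volume (Q.toSet ∩ U) ≤ volume U := measure_mono inter_subset_right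
      _ ≤ _ := hUQ
      _ ≤ _ := by
        gcongr
        rw [hh, pow_succ _ (d + 1)]
        exact mul_le_of_le_one_right' (by simp)
  let sel (n : ℕ) (x : Space d) : Prop := x ∈ Q.toSet ∧ bad n x ∧ ∀ m < n, ¬ bad m x
  let J : Set (ℕ × (Fin d → ℤ)) := {p | ∃ x, sel p.1 x ∧ Q.position p.1 x = p.2}
  let I : Set (Cube d) := (fun p : ℕ × (Fin d → ℤ) => Q.descendant p.1 p.2) '' J
  -- The selection does not depend on the witness: every point of a selected cube selects that same
  -- cube. Disjointness then follows from uniqueness of the first bad generation.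
  have hmem : ∀ P ∈ I, ∀ y ∈ P.toSet, ∃ n, P = Q.descendant n (Q.position n y) ∧ sel n y := by
    rintro _ ⟨⟨n, k⟩, ⟨x, ⟨hxQ, hx1, hx2⟩, hk⟩, rfl⟩ y hy
    rw [mem_descendant_iff] at hy
    dsimp only at hy hk hx1 hx2 ⊢
    subst hk
    have key : ∀ m ≤ n, Q.position m y = Q.position m x := fun m hm => position_eq_of_le hm hy
    refine ⟨n, by rw [hy], ?_, ?_, fun m hm => ?_⟩
    · rw [mem_iff_position_zero] at hxQ ⊢
      rw [key 0 (Nat.zero_le _), hxQ]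
    · simpa only [bad, key n le_rfl] using hx1
    · simpa only [bad, key m hm.le] using hx2 m hm
  have hne : ∀ P : Cube d, P.toSet.Nonempty := fun P => ⟨_, P.center_mem⟩
  have hcov : U ∩ Q.toSet ⊆ ⋃ P ∈ I, P.toSet := by
    rintro x ⟨hxU, hxQ⟩
    -- As `U` is open, a small enough descendant around `x` lies in `U` and has density `1 > h`; no
    -- differentiation theorem is needed.
    have hex : ∃ n, bad n x := by
      obtain ⟨n, hn⟩ := exists_descendant_subset (Q := Q) hU hxU
      refine ⟨n, ?_⟩
      simp only [bad, inter_eq_left.2 hn]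
      set P := Q.descendant n (Q.position n x)
      have : h < 1 := pow_lt_one₀ (by simp) (by simp) (by simp)
      simpa using ENNReal.mul_lt_mul_left P.volume_toSet_ne_zero P.volume_toSet_ne_top this
    classical
    refine mem_biUnion (x := Q.descendant (Nat.find hex) (Q.position (Nat.find hex) x)) ?_
      (mem_descendant_position _ _ _)
    exact ⟨(Nat.find hex, _), ⟨x, ⟨hxQ, Nat.find_spec hex, fun m hm => Nat.find_min hex hm⟩, rfl⟩,
      rfl⟩
  have hdisj : I.PairwiseDisjoint Cube.toSet := by
    intro P hP P' hP' hPP'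
    refine disjoint_left.2 fun y hy hy' => hPP' ?_
    obtain ⟨n, rfl, -, hb, hl⟩ := hmem P hP y hy
    obtain ⟨n', rfl, -, hb', hl'⟩ := hmem P' hP' y hy'
    rcases lt_trichotomy n n' with hn | rfl | hn
    · exact absurd hb (hl' _ hn)
    · rfl
    · exact absurd hb' (hl _ hn)
  have hcount : I.Countable := (Set.to_countable J).image _
  have hsub : ∀ P ∈ I, P.toSet ⊆ Q.toSet := fun P hP y hy => by
    obtain ⟨n, -, hs⟩ := hmem P hP y hy
    exact hs.1
  have hvol : ∀ P ∈ I, volume P.toSet ≤ h⁻¹ * volume (P.toSet ∩ U) := by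
    intro P hP
    obtain ⟨y, hy⟩ := hne P
    obtain ⟨n, rfl, -, hb, -⟩ := hmem P hP y hy
    rw [← ENNReal.div_eq_inv_mul, ENNReal.le_div_iff_mul_le (Or.inl h0) (Or.inl htop), mul_comm]
    exact hb.le
  refine ⟨I, hcount, hdisj, hsub, hcov, ?_, ?_⟩
  · have : Countable I := hcount.to_subtype
    calc volume (⋃ P ∈ I, P.toSet) ≤ ∑' P : I, volume (P : Cube d).toSet :=
          (measure_biUnion hcount hdisj fun P _ => P.measurableSet_toSet).le
      _ ≤ ∑' P : I, h⁻¹ * volume ((P : Cube d).toSet ∩ U) :=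
          ENNReal.tsum_le_tsum fun P => hvol P P.2
      _ = h⁻¹ * volume (⋃ P ∈ I, (P.toSet ∩ U)) := by
          rw [ENNReal.tsum_mul_left, measure_biUnion hcount
            (hdisj.mono fun P => inter_subset_left)
            fun P _ => P.measurableSet_toSet.inter hU.measurableSet]
      _ ≤ h⁻¹ * (2⁻¹ ^ (d + 2) * volume Q.toSet) := by
          gcongr
          exact (measure_mono (iUnion₂_subset fun P _ => inter_subset_right)).trans hUQ
      _ = 2⁻¹ * volume Q.toSet := by
          rw [pow_succ _ (d + 1), ← hh, ← mul_assoc, ← mul_assoc, ENNReal.inv_mul_cancel h0 htop,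
            one_mul]
  · intro P hP
    obtain ⟨y, hy⟩ := hne P
    obtain ⟨n, rfl, hyQ, hb, hl⟩ := hmem P hP y hy
    obtain _ | n := n
    · exact absurd hb (hbad0 y hyQ)
    have hn := hl n n.lt_succ_self
    simp only [bad, not_lt] at hn
    calc _ ≤ volume ((Q.descendant n (Q.position n y)).toSet ∩ U) :=
          measure_mono (inter_subset_inter_left _ (descendant_position_subset n.le_succ y))
      _ ≤ _ := hn
      _ = _ := by
        rw [volume_descendant_succ Q n _ (Q.position (n + 1) y), ← mul_assoc, hh, pow_succ,
          mul_right_comm _ _ (2 ^ d : ℝ≥0∞), ← mul_pow, ENNReal.inv_mul_cancel (by simp) (by simp),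
          one_pow, one_mul]

end Cube

/-! ### From weak oscillation estimates to the maximal function. -/

lemma avgAbs_mul_volume (v : Space d → ℝ) (Q : Cube d) :
    avgAbs v Q * volume Q.toSet = ∫⁻ x in Q.toSet, ‖v x‖ₑ :=
  ENNReal.div_mul_cancel Q.volume_toSet_ne_zero Q.volume_toSet_ne_top

lemma avgAbs_le_maximal_indicator (v : Space d → ℝ) {Q : Cube d} {x : Space d}
    (hx : x ∈ Q.toSet) : avgAbs v Q ≤ maximal (Q.toSet.indicator v) x := by
  refine le_trans (le_of_eq ?_) (le_iSup₂ (f := fun (Q' : Cube d) (_ : x ∈ Q'.toSet) =>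
    avgAbs (Q.toSet.indicator v) Q') Q hx)
  unfold avgAbs
  congr 1
  exact setLIntegral_congr_fun Q.measurableSet_toSet fun y hy => by simp [indicator_of_mem hy]

lemma maximal_indicator_mono (v : Space d → ℝ) {P Q : Cube d} (h : P.toSet ⊆ Q.toSet)
    (x : Space d) : maximal (P.toSet.indicator v) x ≤ maximal (Q.toSet.indicator v) x := by
  refine iSup₂_mono fun R _ => ENNReal.div_le_div_right (lintegral_mono fun y => ?_) _
  by_cases hy : y ∈ P.toSet
  · simp [hy, h hy]
  · simp [hy]

/-- One step of the stopping time construction for a function whose oscillation on every cube is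
controlled, outside a small set, by the average of `v`. -/
lemma exists_stopping_family {g v : Space d → ℝ} {c : Cube d → ℝ} {D : ℝ≥0∞}
    (h : ∀ Q : Cube d, volume {x ∈ Q.toSet | D * avgAbs v Q < ‖g x - c Q‖ₑ} ≤
      2⁻¹ ^ (d + 3) * volume Q.toSet) (Q : Cube d) :
    ∃ I : Set (Cube d), I.Countable ∧ I.PairwiseDisjoint Cube.toSet ∧
      (∀ P ∈ I, P.toSet ⊆ Q.toSet) ∧ volume (⋃ P ∈ I, P.toSet) ≤ 2⁻¹ * volume Q.toSet ∧
      (∀ x ∈ Q.toSet \ ⋃ P ∈ I, P.toSet, ‖g x - c Q‖ₑ ≤ D * avgAbs v Q) ∧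
      ∀ P ∈ I, ‖c P - c Q‖ₑ ≤ D * avgAbs v Q + D * avgAbs v P := by
  have half_lt : ∀ (n m : ℕ) (P : Cube d), m < n →
      2⁻¹ ^ n * volume P.toSet < 2⁻¹ ^ m * volume P.toSet := by
    intro n m P hnm
    have hpow : (2⁻¹ : ℝ≥0) ^ n < 2⁻¹ ^ m :=
      pow_lt_pow_right_of_lt_one₀ (by positivity) (inv_lt_one_of_one_lt₀ one_lt_two) hnm
    have hpow' : (2⁻¹ : ℝ≥0∞) ^ n < 2⁻¹ ^ m := by
      rw [show (2⁻¹ : ℝ≥0∞) = ((2⁻¹ : ℝ≥0) : ℝ≥0∞) by simp]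
      exact_mod_cast hpow
    exact ENNReal.mul_lt_mul_left P.volume_toSet_ne_zero P.volume_toSet_ne_top hpow'
  -- The gap between `2^{-(d+3)}` and `2^{-(d+2)}` leaves room for an open superset of the
  -- exceptional set, which need not be measurable.
  obtain ⟨U, hEU, hU, hUQ⟩ := Set.exists_isOpen_lt_of_lt _ _
    ((h Q).trans_lt (half_lt (d + 3) (d + 2) Q (by omega)))
  obtain ⟨I, hI, hdisj, hsub, hcov, hvol, hhalf⟩ := Q.exists_stopping_cubes hU hUQ.le
  refine ⟨I, hI, hdisj, hsub, hvol, fun x hx => ?_, fun P hP => ?_⟩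
  · by_contra! hlt
    exact hx.2 (hcov ⟨hEU ⟨hx.1, hlt⟩, hx.1⟩)
  -- `U` fills at most half of `P`, and the exceptional set of `P` less than half. A point of `P`
  -- outside both is good for `P` and for `Q`, and there `c P` and `c Q` can be compared.
  · have hlt : volume (P.toSet ∩ U ∪ {x ∈ P.toSet | D * avgAbs v P < ‖g x - c P‖ₑ}) <
        volume P.toSet := by
      have h1 := half_lt (d + 3) 1 P (by omega)
      rw [pow_one] at h1
      calc _ ≤ _ := measure_union_le _ _
        _ < 2⁻¹ * volume P.toSet + 2⁻¹ * volume P.toSet :=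
          ENNReal.add_lt_add_of_le_of_lt
            ((hhalf P hP).trans_lt
              (ENNReal.mul_lt_top (by simp) P.volume_toSet_ne_top.lt_top)).ne
            (hhalf P hP) ((h P).trans_lt h1)
        _ = volume P.toSet := by rw [← add_mul, ENNReal.inv_two_add_inv_two, one_mul]
    obtain ⟨x, hxP, hx⟩ : ∃ x ∈ P.toSet,
        x ∉ P.toSet ∩ U ∪ {x ∈ P.toSet | D * avgAbs v P < ‖g x - c P‖ₑ} := by
      by_contra! hall
      exact hlt.not_ge (measure_mono hall)
    have hxQ : ‖g x - c Q‖ₑ ≤ D * avgAbs v Q := by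
      by_contra! hgt
      exact hx (Or.inl ⟨hxP, hEU ⟨hsub P hP hxP, hgt⟩⟩)
    have hxP' : ‖g x - c P‖ₑ ≤ D * avgAbs v P := by
      by_contra! hgt
      exact hx (Or.inr ⟨hxP, hgt⟩)
    calc ‖c P - c Q‖ₑ = ‖(g x - c Q) - (g x - c P)‖ₑ := by ring_nf
      _ ≤ ‖g x - c Q‖ₑ + ‖g x - c P‖ₑ := enorm_sub_le
      _ ≤ _ := add_le_add hxQ hxP'

/-- The union of the cubes of the `n`-th generation of a family of stopping cubes. -/
def stoppingSet (I : Cube d → Set (Cube d)) : ℕ → Cube d → Set (Space d)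
  | 0, Q => Q.toSet
  | n + 1, Q => ⋃ P ∈ I Q, stoppingSet I n P

lemma stoppingSet_succ_subset {I : Cube d → Set (Cube d)}
    (hsub : ∀ Q, ∀ P ∈ I Q, P.toSet ⊆ Q.toSet) (n : ℕ) (Q : Cube d) :
    stoppingSet I (n + 1) Q ⊆ stoppingSet I n Q := by
  induction n generalizing Q with
  | zero => exact iUnion₂_subset (hsub Q)
  | succ n ih => exact iUnion₂_mono fun P _ => ih P

lemma volume_stoppingSet_le {I : Cube d → Set (Cube d)} (hI : ∀ Q, (I Q).Countable)
    (hdisj : ∀ Q, (I Q).PairwiseDisjoint Cube.toSet)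
    (hvol : ∀ Q : Cube d, volume (⋃ P ∈ I Q, P.toSet) ≤ 2⁻¹ * volume Q.toSet) (n : ℕ)
    (Q : Cube d) : volume (stoppingSet I n Q) ≤ 2⁻¹ ^ n * volume Q.toSet := by
  induction n generalizing Q with
  | zero => simp [stoppingSet]
  | succ n ih =>
    calc volume (stoppingSet I (n + 1) Q) ≤ ∑' P : I Q, volume (stoppingSet I n P) :=
          measure_biUnion_le _ (hI Q) _
      _ ≤ ∑' P : I Q, 2⁻¹ ^ n * volume (P : Cube d).toSet := ENNReal.tsum_le_tsum fun P => ih P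
      _ = 2⁻¹ ^ n * volume (⋃ P ∈ I Q, P.toSet) := by
          rw [ENNReal.tsum_mul_left,
            measure_biUnion (hI Q) (hdisj Q) fun P _ => P.measurableSet_toSet]
      _ ≤ 2⁻¹ ^ n * (2⁻¹ * volume Q.toSet) := by gcongr; exact hvol Q
      _ = _ := by rw [pow_succ, mul_assoc]

/-- Removing the `n`-th generation makes the base case trivial, so no integrability of `g` is
required. With `V` the union of the first generation, one step costs `D ⟨v⟩_Q |Q| + D ∫_V |v| ≤ 2D
⟨v⟩_Q |Q| ≤ 4D ⟨v⟩_Q |Q \ V|`, which is paid by the maximal function on `Q \ V`. The induction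
hypothesis is paid by the maximal function on `V`, so the constant `4D` does not grow with `n`. -/
lemma lintegral_diff_stoppingSet_le {g v : Space d → ℝ} {c : Cube d → ℝ} {D : ℝ≥0∞}
    {I : Cube d → Set (Cube d)} (hI : ∀ Q, (I Q).Countable)
    (hdisj : ∀ Q, (I Q).PairwiseDisjoint Cube.toSet)
    (hsub : ∀ Q, ∀ P ∈ I Q, P.toSet ⊆ Q.toSet)
    (hvol : ∀ Q : Cube d, volume (⋃ P ∈ I Q, P.toSet) ≤ 2⁻¹ * volume Q.toSet)
    (hout : ∀ Q : Cube d, ∀ x ∈ Q.toSet \ ⋃ P ∈ I Q, P.toSet, ‖g x - c Q‖ₑ ≤ D * avgAbs v Q)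
    (hc : ∀ Q, ∀ P ∈ I Q, ‖c P - c Q‖ₑ ≤ D * avgAbs v Q + D * avgAbs v P) (n : ℕ) (Q : Cube d) :
    ∫⁻ x in Q.toSet \ stoppingSet I n Q, ‖g x - c Q‖ₑ ≤
      4 * D * ∫⁻ x in Q.toSet, maximal (Q.toSet.indicator v) x := by
  induction n generalizing Q with
  | zero => simp [stoppingSet]
  | succ n ih =>
    have : Countable (I Q) := (hI Q).to_subtype
    set V : Set (Space d) := ⋃ P ∈ I Q, P.toSet with hV
    have hVm : MeasurableSet V := .biUnion (hI Q) fun P _ => P.measurableSet_toSet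
    have hVQ : V ⊆ Q.toSet := iUnion₂_subset (hsub Q)
    have hdecomp : Q.toSet \ stoppingSet I (n + 1) Q ⊆
        (Q.toSet \ V) ∪ ⋃ P : I Q, ((P : Cube d).toSet \ stoppingSet I n P) := by
      rintro x ⟨hxQ, hx⟩
      by_cases hxV : x ∈ V
      · obtain ⟨P, hP, hxP⟩ := mem_iUnion₂.1 hxV
        exact Or.inr (mem_iUnion.2 ⟨⟨P, hP⟩, hxP, fun hxS => hx (mem_biUnion hP hxS)⟩)
      · exact Or.inl ⟨hxQ, hxV⟩
    have hpiece : ∀ P : I Q, ∫⁻ x in (P : Cube d).toSet \ stoppingSet I n P, ‖g x - c Q‖ₑ ≤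
        4 * D * (∫⁻ x in (P : Cube d).toSet, maximal (Q.toSet.indicator v) x) +
          (D * avgAbs v Q * volume (P : Cube d).toSet + D * ∫⁻ x in (P : Cube d).toSet, ‖v x‖ₑ) := by
      rintro ⟨P, hP⟩
      calc ∫⁻ x in P.toSet \ stoppingSet I n P, ‖g x - c Q‖ₑ
          ≤ ∫⁻ x in P.toSet \ stoppingSet I n P,
              (‖g x - c P‖ₑ + (D * avgAbs v Q + D * avgAbs v P)) := by
            refine lintegral_mono fun x => ?_
            calc ‖g x - c Q‖ₑ = ‖(g x - c P) + (c P - c Q)‖ₑ := by ring_nf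
              _ ≤ _ := (enorm_add_le _ _).trans (add_le_add le_rfl (hc Q P hP))
        _ = (∫⁻ x in P.toSet \ stoppingSet I n P, ‖g x - c P‖ₑ) +
            (D * avgAbs v Q + D * avgAbs v P) * volume (P.toSet \ stoppingSet I n P) := by
            rw [lintegral_add_right _ measurable_const, setLIntegral_const]
        _ ≤ 4 * D * (∫⁻ x in P.toSet, maximal (P.toSet.indicator v) x) +
            (D * avgAbs v Q + D * avgAbs v P) * volume P.toSet := by
            gcongr
            · exact ih P
            · exact sdiff_subset
        _ ≤ _ := by
            rw [add_mul, mul_assoc D (avgAbs v P), avgAbs_mul_volume]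
            gcongr with x
            exact maximal_indicator_mono v (hsub Q P hP) x
    have hdiff : volume Q.toSet ≤ 2 * volume (Q.toSet \ V) := by
      have h1 : volume Q.toSet = volume V + volume (Q.toSet \ V) := by
        rw [← measure_union disjoint_sdiff_right (Q.measurableSet_toSet.diff hVm),
          union_sdiff_cancel hVQ]
      have h2 : 2⁻¹ * volume Q.toSet + volume (Q.toSet \ V) ≥ volume Q.toSet := by
        conv_rhs => rw [h1]
        gcongr
        exact hvol Q
      have h3 : 2⁻¹ * volume Q.toSet + 2⁻¹ * volume Q.toSet = volume Q.toSet := by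
        rw [← add_mul, ENNReal.inv_two_add_inv_two, one_mul]
      have h4 : 2⁻¹ * volume Q.toSet ≤ volume (Q.toSet \ V) := by
        conv_rhs at h2 => rw [← h3]
        exact (ENNReal.add_le_add_iff_left
          (ENNReal.mul_ne_top (by simp) Q.volume_toSet_ne_top)).1 h2
      calc volume Q.toSet = 2 * (2⁻¹ * volume Q.toSet) := by
            rw [← mul_assoc, ENNReal.mul_inv_cancel (by simp) (by simp), one_mul]
        _ ≤ _ := by gcongr
    have hVsum : ∀ φ : Space d → ℝ≥0∞,
        ∑' P : I Q, ∫⁻ x in (P : Cube d).toSet, φ x = ∫⁻ x in V, φ x := fun φ =>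
      (lintegral_biUnion (hI Q) (fun P _ => P.measurableSet_toSet) (hdisj Q) φ).symm
    have hVvol : ∑' P : I Q, volume (P : Cube d).toSet = volume V :=
      (measure_biUnion (hI Q) (hdisj Q) fun P _ => P.measurableSet_toSet).symm
    have hQV : volume (Q.toSet \ V) + volume V = volume Q.toSet := by
      rw [← measure_union disjoint_sdiff_left hVm, sdiff_union_of_subset hVQ]
    calc ∫⁻ x in Q.toSet \ stoppingSet I (n + 1) Q, ‖g x - c Q‖ₑ
        ≤ (∫⁻ x in Q.toSet \ V, ‖g x - c Q‖ₑ) +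
          ∑' P : I Q, ∫⁻ x in (P : Cube d).toSet \ stoppingSet I n P, ‖g x - c Q‖ₑ :=
          (lintegral_mono_set hdecomp).trans ((lintegral_union_le _ _ _).trans
            (add_le_add le_rfl (lintegral_iUnion_le _ _)))
      _ ≤ D * avgAbs v Q * volume (Q.toSet \ V) +
          (4 * D * (∫⁻ x in V, maximal (Q.toSet.indicator v) x) +
            (D * avgAbs v Q * volume V + D * ∫⁻ x in V, ‖v x‖ₑ)) := by
          refine add_le_add ?_ ((ENNReal.tsum_le_tsum hpiece).trans (le_of_eq ?_))
          · rw [← setLIntegral_const]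
            exact setLIntegral_mono measurable_const (hout Q)
          · rw [ENNReal.tsum_add, ENNReal.tsum_add, ENNReal.tsum_mul_left, ENNReal.tsum_mul_left,
              ENNReal.tsum_mul_left, hVsum, hVsum, hVvol]
      _ = D * avgAbs v Q * volume Q.toSet + D * (∫⁻ x in V, ‖v x‖ₑ) +
          4 * D * ∫⁻ x in V, maximal (Q.toSet.indicator v) x := by
          rw [← hQV]; ring
      _ ≤ D * avgAbs v Q * volume Q.toSet + D * (avgAbs v Q * volume Q.toSet) +
          4 * D * ∫⁻ x in V, maximal (Q.toSet.indicator v) x := by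
          rw [avgAbs_mul_volume]
          gcongr
      _ = 2 * D * (avgAbs v Q * volume Q.toSet) +
          4 * D * ∫⁻ x in V, maximal (Q.toSet.indicator v) x := by ring
      _ ≤ 2 * D * (avgAbs v Q * (2 * volume (Q.toSet \ V))) +
          4 * D * ∫⁻ x in V, maximal (Q.toSet.indicator v) x := by gcongr
      _ = 4 * D * (avgAbs v Q * volume (Q.toSet \ V) +
          ∫⁻ x in V, maximal (Q.toSet.indicator v) x) := by ring
      _ ≤ 4 * D * ((∫⁻ x in Q.toSet \ V, maximal (Q.toSet.indicator v) x) +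
          ∫⁻ x in V, maximal (Q.toSet.indicator v) x) := by
          gcongr
          rw [← setLIntegral_const]
          exact setLIntegral_mono' (Q.measurableSet_toSet.diff hVm)
            fun x hx => avgAbs_le_maximal_indicator v hx.1
      _ = _ := by
          rw [← lintegral_union hVm disjoint_sdiff_left, sdiff_union_of_subset hVQ]

/-- Weak local oscillation estimates by averages of `v` imply strong oscillation estimates by the
maximal function of `v`. -/
theorem lintegral_sub_le_lintegral_maximal {g v : Space d → ℝ} {c : Cube d → ℝ} {D : ℝ≥0∞}
    (h : ∀ Q : Cube d, volume {x ∈ Q.toSet | D * avgAbs v Q < ‖g x - c Q‖ₑ} ≤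
      2⁻¹ ^ (d + 3) * volume Q.toSet) (Q : Cube d) :
    ∫⁻ x in Q.toSet, ‖g x - c Q‖ₑ ≤
      4 * D * ∫⁻ x in Q.toSet, maximal (Q.toSet.indicator v) x := by
  choose I hI hdisj hsub hvol hout hc using exists_stopping_family h
  -- The generations shrink geometrically to a null set, so monotone convergence over their
  -- complements recovers the integral over `Q`.
  have hnull : volume (⋂ n, stoppingSet I n Q) = 0 := by
    refine le_antisymm (ge_of_tendsto' (x := Filter.atTop)
      (f := fun n : ℕ => 2⁻¹ ^ n * volume Q.toSet) ?_ fun n =>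
        (measure_mono (iInter_subset _ n)).trans (volume_stoppingSet_le hI hdisj hvol n Q)) bot_le
    rw [← zero_mul (volume Q.toSet)]
    exact ENNReal.Tendsto.mul_const (ENNReal.tendsto_pow_atTop_nhds_zero_of_lt_one (by simp))
      (Or.inr Q.volume_toSet_ne_top)
  have hcov : Q.toSet ⊆ (⋃ n, Q.toSet \ stoppingSet I n Q) ∪ ⋂ n, stoppingSet I n Q := by
    rw [← sdiff_iInter, sdiff_union_self]
    exact subset_union_left
  calc ∫⁻ x in Q.toSet, ‖g x - c Q‖ₑ
      ≤ (∫⁻ x in ⋃ n, Q.toSet \ stoppingSet I n Q, ‖g x - c Q‖ₑ) +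
        ∫⁻ x in ⋂ n, stoppingSet I n Q, ‖g x - c Q‖ₑ :=
        (lintegral_mono_set hcov).trans (lintegral_union_le _ _ _)
    _ = ⨆ n, ∫⁻ x in Q.toSet \ stoppingSet I n Q, ‖g x - c Q‖ₑ := by
        rw [setLIntegral_measure_zero _ _ hnull, add_zero, setLIntegral_iUnion_of_directed]
        exact (monotone_nat_of_le_succ fun n =>
          sdiff_subset_sdiff_right (stoppingSet_succ_subset hsub n Q)).directed_le
    _ ≤ _ := iSup_le fun n =>
        lintegral_diff_stoppingSet_le hI hdisj hsub hvol hout hc n Q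

/-! ### The modulus and the constant `[v]_{B(Ω)}`. -/

lemma IsModulus.map_natCast_mul_le {Ω : ℝ≥0 → ℝ≥0} (hΩ : IsModulus Ω) (n : ℕ) (t : ℝ≥0) :
    Ω (n * t) ≤ n * Ω t := by
  induction n with
  | zero => simp [hΩ.zero]
  | succ n ih =>
    push_cast
    rw [add_mul, add_mul, one_mul, one_mul]
    exact (hΩ.subadd _ _).trans (add_le_add ih le_rfl)

lemma IsModulus.map_le_natCast_mul {Ω : ℝ≥0 → ℝ≥0} (hΩ : IsModulus Ω) (n : ℕ) {s t : ℝ}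
    (hst : s ≤ n * t) : Ω s.toNNReal ≤ n * Ω t.toNNReal := by
  refine le_trans (hΩ.mono ?_) (hΩ.map_natCast_mul_le n t.toNNReal)
  rw [← Real.toNNReal_natCast, ← Real.toNNReal_mul n.cast_nonneg]
  exact Real.toNNReal_le_toNNReal hst

/-- The integral that defines `[v]_{B(Ω)}`. -/
def tailIntegral (Ω : ℝ≥0 → ℝ≥0) (v : Space d → ℝ) (Q : Cube d) : ℝ≥0∞ :=
  ∫⁻ x in Q.toSetᶜ, ENNReal.ofReal (v x / ‖x - Q.center‖ ^ d) *
    (Ω (Q.side / ‖x - Q.center‖).toNNReal : ℝ≥0∞)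

lemma volume_mul_tailIntegral_le (Ω : ℝ≥0 → ℝ≥0) {v : Space d → ℝ} {Q : Cube d}
    (h0 : mass v Q.toSet ≠ 0) (htop : mass v Q.toSet ≠ ∞) :
    volume Q.toSet * tailIntegral Ω v Q ≤ bConst Ω v * mass v Q.toSet := by
  have h : volume Q.toSet / mass v Q.toSet * tailIntegral Ω v Q ≤ bConst Ω v :=
    le_iSup (f := fun Q : Cube d => volume Q.toSet / mass v Q.toSet * tailIntegral Ω v Q) Q
  rwa [← ENNReal.div_le_iff h0 htop, ENNReal.mul_div_right_comm]

/-- A ball around the center of `Q` that is large enough to contain the singular part of a kernel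
on `Q`. -/
def Cube.bigBall (Q : Cube d) : Set (Space d) := Metric.ball Q.center (4 * d * Q.side)

lemma Cube.subset_bigBall (hd : 1 ≤ d) (Q : Cube d) : Q.toSet ⊆ Q.bigBall := fun x hx => by
  rw [bigBall, Metric.mem_ball, dist_eq_norm]
  refine (norm_sub_le hx Q.center_mem).trans_lt ?_
  have hd' : (0 : ℝ) < d := by exact_mod_cast hd
  have := mul_pos hd' Q.side_pos
  linarith

/-- The witness is the translate of `Q` by its side length in every coordinate, which is disjoint
from `Q` and still inside the ball. -/
lemma Cube.volume_le_volume_bigBall_diff (hd : 1 ≤ d) (Q : Cube d) :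
    volume Q.toSet ≤ volume (Q.bigBall \ Q.toSet) := by
  let i₀ : Fin d := ⟨0, hd⟩
  let P : Cube d := ⟨WithLp.toLp 2 fun i => Q.corner i + Q.side, Q.side, Q.side_pos⟩
  have hPQ : volume Q.toSet = volume P.toSet := by rw [volume_toSet, volume_toSet]
  rw [hPQ]
  refine measure_mono fun x hx => ⟨?_, fun hxQ => ?_⟩
  · rw [bigBall, Metric.mem_ball, dist_eq_norm]
    have hs := Q.side_pos
    have hd' : (0 : ℝ) < d := by exact_mod_cast hd
    have := mul_pos hd' hs
    refine (norm_le_of_abs_apply_le (r := 2 * Q.side) (by linarith) fun i => ?_).trans_lt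
      (by linarith)
    have h1 := hx i
    simp only [P] at h1
    rw [PiLp.sub_apply, abs_le]
    simp only [center]
    constructor <;> linarith
  · have h1 := (hx i₀).1
    have h2 := (hxQ i₀).2
    simp only [P] at h1
    linarith

/-- In the ball `r = |y - c_Q| ≤ 4dℓ`. Hence `1 ≤ (4dℓ)^d / r^d`, and `Ω(1) ≤ 4d Ω(ℓ/r)` by
subadditivity; together these give the factor `(4d)^{d+1}`. -/
lemma lintegral_bigBall_diff_mul_le (hd : 1 ≤ d) {Ω : ℝ≥0 → ℝ≥0} (hΩ : IsModulus Ω)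
    (v : Space d → ℝ) (Q : Cube d) :
    mass v (Q.bigBall \ Q.toSet) * Ω 1 ≤
      (4 * d) ^ (d + 1) * (volume Q.toSet * tailIntegral Ω v Q) := by
  have hs := Q.side_pos
  have hd' : (0 : ℝ) < d := by exact_mod_cast hd
  have hm : MeasurableSet (Q.bigBall \ Q.toSet) :=
    Metric.isOpen_ball.measurableSet.diff Q.measurableSet_toSet
  have hcv : volume Q.toSet ≠ ∞ := Q.volume_toSet_ne_top
  rw [tailIntegral, ← mul_assoc, mass, ← lintegral_mul_const' _ _ ENNReal.coe_ne_top,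
    ← lintegral_const_mul' _ _ (ENNReal.mul_ne_top (ENNReal.pow_ne_top
      (ENNReal.mul_ne_top (by simp) (by simp))) hcv)]
  refine (setLIntegral_mono' hm fun y hy => ?_).trans
    (lintegral_mono_set fun y hy => hy.2)
  set r := ‖y - Q.center‖ with hr
  have hr0 : 0 < r := lt_of_lt_of_le (by linarith) (Cube.le_norm_sub_center hy.2)
  have hrle : r ≤ 4 * d * Q.side := by
    have := hy.1
    rw [Cube.bigBall, Metric.mem_ball, dist_eq_norm] at this
    exact this.le
  have h1 : (Ω 1 : ℝ≥0∞) ≤ (4 * d) * (Ω (Q.side / r).toNNReal : ℝ≥0∞) := by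
    have : Ω (1 : ℝ).toNNReal ≤ ((4 * d : ℕ) : ℝ≥0) * Ω (Q.side / r).toNNReal := by
      refine hΩ.map_le_natCast_mul _ ?_
      push_cast
      rw [← mul_div_assoc, le_div_iff₀ hr0]
      linarith
    rw [Real.toNNReal_one] at this
    exact_mod_cast this
  have h2 : ENNReal.ofReal (v y) ≤
      (4 * d) ^ d * volume Q.toSet * ENNReal.ofReal (v y / r ^ d) := by
    rcases le_or_gt (v y) 0 with hv | hv
    · simp [ENNReal.ofReal_of_nonpos hv]
    rw [Cube.volume_toSet, show (4 * d : ℝ≥0∞) = ENNReal.ofReal (4 * d) by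
      rw [ENNReal.ofReal_mul (by norm_num)]; simp, ← mul_pow,
      ← ENNReal.ofReal_mul (by positivity), ← ENNReal.ofReal_pow (by positivity),
      ← ENNReal.ofReal_mul (by positivity)]
    refine ENNReal.ofReal_le_ofReal ?_
    rw [← mul_div_assoc, le_div_iff₀ (by positivity), mul_comm]
    gcongr
  calc ENNReal.ofReal (v y) * Ω 1 ≤ ((4 * d) ^ d * volume Q.toSet * ENNReal.ofReal (v y / r ^ d)) *
        ((4 * d) * (Ω (Q.side / r).toNNReal : ℝ≥0∞)) := mul_le_mul' h2 h1
    _ = _ := by ring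

lemma mass_one (E : Set (Space d)) : mass (fun _ => 1) E = volume E := by
  simp [mass]

/-- Test `[1]_B` on the unit cube. This lets `[1]_B` absorb the contribution of `Q` to the mass of
the big ball. -/
lemma map_one_le_bConst_one (hd : 1 ≤ d) {Ω : ℝ≥0 → ℝ≥0} (hΩ : IsModulus Ω) :
    (Ω 1 : ℝ≥0∞) ≤ (4 * d) ^ (d + 1) * bConst Ω (fun _ : Space d => 1) := by
  let Q : Cube d := ⟨0, 1, one_pos⟩
  have h0 : mass (fun _ => 1) Q.toSet ≠ 0 := by rw [mass_one]; exact Q.volume_toSet_ne_zero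
  have ht : mass (fun _ => 1) Q.toSet ≠ ∞ := by rw [mass_one]; exact Q.volume_toSet_ne_top
  have h1 := lintegral_bigBall_diff_mul_le hd hΩ (fun _ => 1) Q
  have h2 := volume_mul_tailIntegral_le Ω h0 ht
  rw [mass_one] at h1 h2
  have h3 : volume Q.toSet = 1 := by simp [Cube.volume_toSet, Q]
  have h4 := Q.volume_le_volume_bigBall_diff hd
  rw [h3] at h2 h4
  calc (Ω 1 : ℝ≥0∞) = 1 * Ω 1 := (one_mul _).symm
    _ ≤ _ := mul_le_mul' h4 le_rfl
    _ ≤ _ := h1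
    _ ≤ _ := by rw [h3]; exact mul_le_mul' le_rfl (h2.trans (by rw [mul_one]))

lemma mass_bigBall_mul_le (hd : 1 ≤ d) {Ω : ℝ≥0 → ℝ≥0} (hΩ : IsModulus Ω)
    {v : Space d → ℝ} {Q : Cube d} (h0 : mass v Q.toSet ≠ 0) (htop : mass v Q.toSet ≠ ∞) :
    mass v Q.bigBall * Ω 1 ≤ (4 * d) ^ (d + 1) *
      ((bConst Ω (fun _ : Space d => 1) + bConst Ω v) * mass v Q.toSet) := by
  have hsplit : mass v Q.bigBall ≤ mass v (Q.bigBall \ Q.toSet) + mass v Q.toSet := by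
    refine le_trans (lintegral_mono_set ?_) (lintegral_union_le _ _ _)
    rw [sdiff_union_self]
    exact subset_union_left
  calc mass v Q.bigBall * Ω 1 ≤ (mass v (Q.bigBall \ Q.toSet) + mass v Q.toSet) * Ω 1 := by gcongr
    _ = mass v (Q.bigBall \ Q.toSet) * Ω 1 + Ω 1 * mass v Q.toSet := by ring
    _ ≤ (4 * d) ^ (d + 1) * (bConst Ω v * mass v Q.toSet) +
        (4 * d) ^ (d + 1) * bConst Ω (fun _ : Space d => 1) * mass v Q.toSet := by
        refine add_le_add ?_ (mul_le_mul' (map_one_le_bConst_one hd hΩ) le_rfl)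
        exact (lintegral_bigBall_diff_mul_le hd hΩ v Q).trans
          (mul_le_mul' le_rfl (volume_mul_tailIntegral_le Ω h0 htop))
    _ = _ := by ring

/-! ### The local oscillation estimate for `Tf`. -/

/-- With `r = |y - c_Q| ≥ 4dℓ` one has `|x - z| ≤ dℓ` and `|x - y| ≥ r/2`, so the ratio in the
smoothness condition is at most `2dℓ/r`. -/
lemma IsSmoothKernel.abs_sub_le (hd : 1 ≤ d) {Ω : ℝ≥0 → ℝ≥0} (hΩ : IsModulus Ω)
    {K : Space d → Space d → ℝ} (hK : IsSmoothKernel Ω K) {Q : Cube d} {x z y : Space d}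
    (hx : x ∈ Q.toSet) (hz : z ∈ Q.toSet) (hy : y ∉ Q.bigBall) :
    |K x y - K z y| ≤ d * 2 ^ (d + 1) * ((Ω (Q.side / ‖y - Q.center‖).toNNReal : ℝ) *
      (1 / ‖y - Q.center‖ ^ d)) := by
  have hd' : (0 : ℝ) < d := by exact_mod_cast hd
  have hs := Q.side_pos
  set r := ‖y - Q.center‖ with hr
  have hrle : 4 * d * Q.side ≤ r := by
    rwa [Cube.bigBall, Metric.mem_ball, dist_eq_norm, not_lt] at hy
  have hds := mul_pos hd' hs
  have hr0 : 0 < r := by linarith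
  rcases eq_or_ne x z with rfl | hxz
  · rw [sub_self, abs_zero]
    positivity
  have hxz0 : 0 < ‖x - z‖ := norm_pos_iff.2 (sub_ne_zero.2 hxz)
  have h1 := Cube.norm_sub_le hx hz
  have h2 := Cube.norm_sub_le hx Q.center_mem
  have h3 : r ≤ ‖x - y‖ + ‖x - Q.center‖ := by
    rw [hr, show y - Q.center = (x - Q.center) - (x - y) by abel, add_comm]
    exact _root_.norm_sub_le _ _
  have h4 : r / 2 ≤ ‖x - y‖ := by linarith
  refine (hK x y z (by linarith) (by linarith)).trans ?_
  have h5 : (Ω (‖x - z‖ / ‖x - y‖).toNNReal : ℝ) ≤ 2 * d * (Ω (Q.side / r).toNNReal : ℝ) := by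
    have := hΩ.map_le_natCast_mul (2 * d) (s := ‖x - z‖ / ‖x - y‖) (t := Q.side / r) ?_
    · exact_mod_cast this
    · push_cast
      calc ‖x - z‖ / ‖x - y‖ ≤ (d * Q.side) / (r / 2) := by gcongr
        _ = _ := by field_simp
  have h6 : 1 / ‖x - y‖ ^ d ≤ 2 ^ d * (1 / r ^ d) := by
    calc 1 / ‖x - y‖ ^ d ≤ 1 / (r / 2) ^ d := by gcongr
      _ = _ := by rw [div_pow]; field_simp
  calc _ ≤ (2 * d * (Ω (Q.side / r).toNNReal : ℝ)) * (2 ^ d * (1 / r ^ d)) := by gcongr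
    _ = _ := by ring

/-- The constant in the local oscillation estimate. -/
def localConst (d : ℕ) : ℝ≥0 := 2 * 2 ^ (d + 3) * (4 * d) ^ (d + 1)

lemma avgAbs_eq_mass_div {v : Space d → ℝ} (hv : ∀ᵐ x, 0 < v x) (Q : Cube d) :
    avgAbs v Q = mass v Q.toSet / volume Q.toSet := by
  unfold avgAbs mass
  congr 1
  refine lintegral_congr_ae (ae_restrict_of_ae (hv.mono fun x hx => ?_))
  exact Real.enorm_eq_ofReal hx.le

/-- On `Q`, the image of a function supported away from `Q` is almost constant. -/
lemma exists_const_ae_enorm_sub_le (hd : 1 ≤ d) {Ω : ℝ≥0 → ℝ≥0} (hΩ : IsModulus Ω)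
    {T : Operator d} {K : Space d → Space d → ℝ} (hTK : IsRepresentedBy T K)
    (hK : IsSmoothKernel Ω K) {v f : Space d → ℝ} {N : ℝ≥0∞} (hN : N ≠ ∞)
    (hfv : ∀ᵐ x, ‖f x‖ₑ ≤ N * ENNReal.ofReal (v x)) (hf : Integrable f volume)
    (hfc : HasCompactSupport f) (Q : Cube d) (hfQ : ∀ y ∈ Q.bigBall, f y = 0) :
    ∃ c : ℝ, ∀ᵐ x, x ∈ Q.toSet →
      ‖T (hf.toL1 f) x - c‖ₑ ≤ d * 2 ^ (d + 1) * N * tailIntegral Ω v Q := by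
  have hsupp : ∀ x ∈ Q.toSet, x ∉ tsupport f := by
    intro x hx hx'
    have hsub : tsupport f ⊆ Q.bigBallᶜ :=
      closure_minimal (fun y hy hyB => hy (hfQ y hyB)) Metric.isOpen_ball.isClosed_compl
    exact hsub hx' (Q.subset_bigBall hd hx)
  have hrep := hTK f hf hfc
  -- The kernel formula holds only almost everywhere, so the reference point is some good point of
  -- `Q` rather than its center.
  obtain ⟨z, hzQ, hz⟩ : ∃ z ∈ Q.toSet,
      Integrable (fun y => K z y * f y) volume ∧ T (hf.toL1 f) z = ∫ y, K z y * f y := by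
    by_contra! hcon
    refine Q.volume_toSet_ne_zero (measure_mono_null (fun x hx => ?_) (ae_iff.1 hrep))
    exact fun h => hcon x hx (h (hsupp x hx)).1 (h (hsupp x hx)).2
  refine ⟨T (hf.toL1 f) z, hrep.mono fun x hx hxQ => ?_⟩
  obtain ⟨hxi, hxe⟩ := hx (hsupp x hxQ)
  rw [hxe, hz.2, ← integral_sub hxi hz.1]
  refine (enorm_integral_le_lintegral_enorm _).trans ?_
  have hconst : (d * 2 ^ (d + 1) * N : ℝ≥0∞) ≠ ∞ :=
    ENNReal.mul_ne_top (ENNReal.mul_ne_top (by simp) (ENNReal.pow_ne_top (by simp))) hN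
  have hzero : ∀ y ∈ Q.toSet, ‖K x y * f y - K z y * f y‖ₑ = 0 := fun y hy => by
    simp [hfQ y (Q.subset_bigBall hd hy)]
  rw [← lintegral_add_compl _ Q.measurableSet_toSet,
    setLIntegral_eq_zero Q.measurableSet_toSet hzero, zero_add, tailIntegral,
    ← lintegral_const_mul' _ _ hconst]
  refine lintegral_mono_ae (ae_restrict_of_ae (hfv.mono fun y hy => ?_))
  by_cases hyB : y ∈ Q.bigBall
  · simp [hfQ y hyB]
  set r := ‖y - Q.center‖
  have h1 : ‖K x y - K z y‖ₑ ≤ d * 2 ^ (d + 1) * ((Ω (Q.side / r).toNNReal : ℝ≥0∞) *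
      ENNReal.ofReal (1 / r ^ d)) := by
    rw [Real.enorm_eq_ofReal_abs]
    refine (ENNReal.ofReal_le_ofReal (hK.abs_sub_le hd hΩ hxQ hzQ hyB)).trans (le_of_eq ?_)
    rw [ENNReal.ofReal_mul (by positivity), ENNReal.ofReal_mul (by positivity),
      ENNReal.ofReal_mul (by positivity), ENNReal.ofReal_coe_nnreal, ENNReal.ofReal_natCast,
      ENNReal.ofReal_pow zero_le_two, ENNReal.ofReal_ofNat]
  rw [← sub_mul, enorm_mul]
  calc ‖K x y - K z y‖ₑ * ‖f y‖ₑ ≤ (d * 2 ^ (d + 1) * ((Ω (Q.side / r).toNNReal : ℝ≥0∞) *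
        ENNReal.ofReal (1 / r ^ d))) * (N * ENNReal.ofReal (v y)) := mul_le_mul' h1 hy
    _ = d * 2 ^ (d + 1) * N * ((ENNReal.ofReal (v y) * ENNReal.ofReal (1 / r ^ d)) *
        (Ω (Q.side / r).toNNReal : ℝ≥0∞)) := by ring
    _ = _ := by rw [← ENNReal.ofReal_mul' (by positivity), mul_one_div]

lemma IsWeakType.volume_lt_le {Ω : ℝ≥0 → ℝ≥0} (hd : 1 ≤ d) (hΩ : IsModulus Ω) (hΩ1 : 0 < Ω 1)
    {T : Operator d} {A : ℝ≥0} (hT : IsWeakType T A) {v f : Space d → ℝ} {N : ℝ≥0∞}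
    (hN : N ≠ ∞) (hfv : ∀ᵐ x, ‖f x‖ₑ ≤ N * ENNReal.ofReal (v x)) (hf : Integrable f volume)
    {Q : Cube d} (hfQ : ∀ y ∉ Q.bigBall, f y = 0) (h0 : mass v Q.toSet ≠ 0)
    (htop : mass v Q.toSet ≠ ∞) {s : ℝ≥0} (hs : 0 < s)
    (hle : 2 ^ (d + 3) * (4 * d) ^ (d + 1) * ((1 + A / Ω 1 : ℝ≥0) : ℝ≥0∞) *
      ((bConst Ω (fun _ : Space d => 1) + bConst Ω v) * N * mass v Q.toSet) ≤
        s * volume Q.toSet) :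
    volume {x | (s : ℝ≥0∞) < ‖T (hf.toL1 f) x‖ₑ} ≤ 2⁻¹ ^ (d + 3) * volume Q.toSet := by
  have hnorm : ‖hf.toL1 f‖ₑ ≤ N * mass v Q.bigBall := by
    rw [Integrable.enorm_toL1, ← lintegral_add_compl _ Metric.isOpen_ball.measurableSet,
      setLIntegral_eq_zero (s := (Metric.ball Q.center (4 * d * Q.side))ᶜ)
        Metric.isOpen_ball.measurableSet.compl fun y hy => ?_, add_zero, mass,
      ← lintegral_const_mul' _ _ hN]
    · exact lintegral_mono_ae (ae_restrict_of_ae hfv)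
    · simp [hfQ y hy]
  have hs0 : (s : ℝ≥0∞) ≠ 0 := by exact_mod_cast hs.ne'
  -- The doubling estimate for `v` on the big ball carries a factor `Ω(1)`; this is the origin of
  -- the quotient `A / Ω(1)`.
  have hA : (A : ℝ≥0∞) = ((A / Ω 1 : ℝ≥0) : ℝ≥0∞) * Ω 1 := by
    rw [← ENNReal.coe_mul, div_mul_cancel₀ _ hΩ1.ne']
  have key : (s : ℝ≥0∞) * volume {x | (s : ℝ≥0∞) < ‖T (hf.toL1 f) x‖ₑ} ≤
      s * (2⁻¹ ^ (d + 3) * volume Q.toSet) := by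
    calc _ ≤ (A : ℝ≥0∞) * ‖hf.toL1 f‖ₑ := hT _ s hs
      _ ≤ A * (N * mass v Q.bigBall) := by gcongr
      _ = ((A / Ω 1 : ℝ≥0) : ℝ≥0∞) * N * (mass v Q.bigBall * Ω 1) := by rw [hA]; ring
      _ ≤ ((1 + A / Ω 1 : ℝ≥0) : ℝ≥0∞) * N * ((4 * d) ^ (d + 1) *
          ((bConst Ω (fun _ : Space d => 1) + bConst Ω v) * mass v Q.toSet)) := by
          refine mul_le_mul' (mul_le_mul' ?_ le_rfl) (mass_bigBall_mul_le hd hΩ h0 htop)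
          exact_mod_cast le_add_of_nonneg_left zero_le_one
      _ = 2⁻¹ ^ (d + 3) * (2 ^ (d + 3) * (4 * d) ^ (d + 1) * ((1 + A / Ω 1 : ℝ≥0) : ℝ≥0∞) *
          ((bConst Ω (fun _ : Space d => 1) + bConst Ω v) * N * mass v Q.toSet)) := by
          rw [mul_assoc ((2 : ℝ≥0∞) ^ (d + 3)), mul_assoc ((2 : ℝ≥0∞) ^ (d + 3)),
            ← mul_assoc (2⁻¹ ^ (d + 3)), ← mul_pow, ENNReal.inv_mul_cancel (by simp) (by simp),
            one_pow, one_mul]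
          ring
      _ ≤ 2⁻¹ ^ (d + 3) * (s * volume Q.toSet) := by gcongr
      _ = _ := by ring
  exact (ENNReal.mul_le_mul_iff_right hs0 ENNReal.coe_ne_top).1 key

lemma exists_const_volume_le (hd : 1 ≤ d) {Ω : ℝ≥0 → ℝ≥0} {A : ℝ≥0} {T : Operator d}
    {K : Space d → Space d → ℝ} (hΩ : IsModulus Ω) (hΩ1 : 0 < Ω 1) (hT : IsWeakType T A)
    (hTK : IsRepresentedBy T K) (hK : IsSmoothKernel Ω K) {v f : Space d → ℝ} {N : ℝ≥0∞}
    (hN : N ≠ ∞) (hv : ∀ᵐ x, 0 < v x)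
    (hfv : ∀ᵐ x, ‖f x‖ₑ ≤ N * ENNReal.ofReal (v x)) (hf : Integrable f volume)
    (hfc : HasCompactSupport f) (Q : Cube d) (h0 : mass v Q.toSet ≠ 0)
    (htop : mass v Q.toSet ≠ ∞) :
    ∃ c : ℝ, volume {x ∈ Q.toSet | localConst d * ((1 + A / Ω 1 : ℝ≥0) : ℝ≥0∞) *
        ((bConst Ω (fun _ : Space d => 1) + bConst Ω v) * N) * avgAbs v Q <
          ‖T (hf.toL1 f) x - c‖ₑ} ≤ 2⁻¹ ^ (d + 3) * volume Q.toSet := by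
  set β := bConst Ω (fun _ : Space d => 1) + bConst Ω v with hβ
  set τ := localConst d * ((1 + A / Ω 1 : ℝ≥0) : ℝ≥0∞) * (β * N) * avgAbs v Q with hτ
  rcases eq_or_ne τ ∞ with hτtop | hτtop
  · exact ⟨0, by simp [hτtop]⟩
  -- For `N = 0` the threshold vanishes and the weak type bound says nothing, but then `f = 0`
  -- almost everywhere and `Tf = 0`.
  rcases eq_or_ne N 0 with rfl | hN0
  · refine ⟨0, ?_⟩
    have hf0 : hf.toL1 f = 0 := by
      rw [← enorm_eq_zero, Integrable.enorm_toL1]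
      refine lintegral_eq_zero_of_ae_eq_zero (hfv.mono fun x hx => ?_)
      simpa using hx
    have : volume {x ∈ Q.toSet | τ < ‖T (hf.toL1 f) x - 0‖ₑ} = 0 := by
      rw [hf0, map_zero]
      have h0 : ∀ᵐ x : Space d, (0 : Space d →ₘ[volume] ℝ) x = 0 := AEEqFun.coeFn_zero
      refine measure_mono_null (fun x hx => ?_) (ae_iff.1 h0)
      intro hx0
      simpa [hx0] using hx.2
    rw [this]
    exact bot_le
  have hd0 : (d : ℝ≥0∞) ≠ 0 := by exact_mod_cast (Nat.one_le_iff_ne_zero.1 hd)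
  have hβ0 : β ≠ 0 := by
    intro h
    have h1 := map_one_le_bConst_one hd hΩ
    rw [(add_eq_zero.1 (hβ.symm.trans h)).1, mul_zero] at h1
    exact hΩ1.ne' (by simpa using h1)
  have havg : avgAbs v Q * volume Q.toSet = mass v Q.toSet := by
    rw [avgAbs_eq_mass_div hv, ENNReal.div_mul_cancel Q.volume_toSet_ne_zero Q.volume_toSet_ne_top]
  have ha0 : avgAbs v Q ≠ 0 := fun h => h0 (by rw [← havg, h, zero_mul])
  -- Half of the threshold `τ`: one half is the level for the near part, the other bounds the far
  -- part.
  set σ := 2 ^ (d + 3) * (4 * d) ^ (d + 1) * ((1 + A / Ω 1 : ℝ≥0) : ℝ≥0∞) * (β * N) * avgAbs v Q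
    with hσ
  have hτσ : τ = σ + σ := by
    rw [hτ, hσ, localConst]
    push_cast
    ring
  have hσtop : σ ≠ ∞ := fun h => hτtop (by rw [hτσ, h, top_add])
  have hσ0 : σ ≠ 0 := by
    refine mul_ne_zero (mul_ne_zero (mul_ne_zero (mul_ne_zero ?_ ?_) ?_) (mul_ne_zero hβ0 hN0)) ha0
    · simp
    · exact pow_ne_zero _ (mul_ne_zero (by simp) hd0)
    · simp
  lift σ to ℝ≥0 using hσtop with s hs
  have hBm : MeasurableSet Q.bigBall := Metric.isOpen_ball.measurableSet
  have hf1 := hf.indicator hBm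
  have hf2 := hf.indicator hBm.compl
  have hadd : hf.toL1 f = hf1.toL1 _ + hf2.toL1 _ := by
    rw [← Integrable.toL1_add, Integrable.toL1_eq_toL1_iff]
    rw [indicator_self_add_compl]
  have hle (E : Set (Space d)) :
      ∀ᵐ x, ‖E.indicator f x‖ₑ ≤ N * ENNReal.ofReal (v x) :=
    hfv.mono fun x hx => (enorm_indicator_le_enorm_self f x).trans hx
  obtain ⟨c, hc⟩ := exists_const_ae_enorm_sub_le hd hΩ hTK hK hN (hle _) hf2
    (hfc.mono (by
      rw [support_indicator]
      exact inter_subset_right)) Q (fun y hy => by simp [hy])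
  have htail : d * 2 ^ (d + 1) * N * tailIntegral Ω v Q ≤ s := by
    have h1 : tailIntegral Ω v Q ≤ β * avgAbs v Q := by
      rw [avgAbs_eq_mass_div hv, ← mul_div_assoc, ENNReal.le_div_iff_mul_le
        (Or.inl Q.volume_toSet_ne_zero) (Or.inl Q.volume_toSet_ne_top), mul_comm]
      exact (volume_mul_tailIntegral_le Ω h0 htop).trans (mul_le_mul' le_add_self le_rfl)
    have h2 : (d : ℝ≥0∞) ≤ (4 * d) ^ (d + 1) := by
      exact_mod_cast (show d ≤ (4 * d) ^ (d + 1) from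
        (by omega : d ≤ 4 * d).trans (Nat.le_self_pow (Nat.succ_ne_zero d) _))
    have h3 : (2 : ℝ≥0∞) ^ (d + 1) ≤ 2 ^ (d + 3) := by
      exact_mod_cast Nat.pow_le_pow_right two_pos (by omega)
    have h4 : (1 : ℝ≥0∞) ≤ ((1 + A / Ω 1 : ℝ≥0) : ℝ≥0∞) := by
      exact_mod_cast le_add_of_nonneg_right (b := A / Ω 1) bot_le
    calc d * 2 ^ (d + 1) * N * tailIntegral Ω v Q
        ≤ (4 * d) ^ (d + 1) * 2 ^ (d + 3) * N * (β * avgAbs v Q) * 1 := by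
          rw [mul_one]
          gcongr
      _ ≤ (4 * d) ^ (d + 1) * 2 ^ (d + 3) * N * (β * avgAbs v Q) *
          ((1 + A / Ω 1 : ℝ≥0) : ℝ≥0∞) := by gcongr
      _ = s := by rw [hσ]; ring
  have hweak := hT.volume_lt_le hd hΩ hΩ1 hN (hle Q.bigBall) hf1 (Q := Q)
    (fun y hy => by simp [hy]) h0 htop (s := s)
    (pos_iff_ne_zero.2 fun h => hσ0 (by simp [h])) (by
      rw [hσ, mul_assoc _ (avgAbs v Q), havg, ← hβ]
      exact le_of_eq (by ring))
  refine ⟨c, le_trans (measure_mono_ae ?_) hweak⟩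
  have hcoe : ∀ᵐ x, T (hf.toL1 f) x = T (hf1.toL1 _) x + T (hf2.toL1 _) x := by
    rw [hadd, map_add]
    exact AEEqFun.coeFn_add _ _
  filter_upwards [hc, hcoe] with x hx hxe hmem
  obtain ⟨hxQ, hlt⟩ := hmem
  rw [hτσ, hxe, add_sub_assoc] at hlt
  by_contra hcon
  exact hlt.not_ge ((enorm_add_le _ _).trans
    (add_le_add (not_lt.1 hcon) ((hx hxQ).trans htail)))

/-! ### The first estimate. -/

lemma osc_mul_volume_le {g : Space d → ℝ} (hg : AEStronglyMeasurable g volume) (c : ℝ)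
    (Q : Cube d) : osc g Q * volume Q.toSet ≤ 2 * ∫⁻ x in Q.toSet, ‖g x - c‖ₑ := by
  -- In the finite case `g` is integrable on `Q`, so its Bochner average is the true mean and not
  -- the default value.
  rcases eq_or_ne (∫⁻ x in Q.toSet, ‖g x - c‖ₑ) ∞ with htop | htop
  · simp [htop]
  have : IsFiniteMeasure (volume.restrict Q.toSet) :=
    ⟨by simpa using Q.volume_toSet_ne_top.lt_top⟩
  have hgc : Integrable (fun x => g x - c) (volume.restrict Q.toSet) :=
    ⟨hg.restrict.sub aestronglyMeasurable_const, htop.lt_top⟩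
  have hgi : Integrable g (volume.restrict Q.toSet) := by
    refine (hgc.add (integrable_const c)).congr (Filter.Eventually.of_forall fun x => ?_)
    simp
  set m := ⨍ y in Q.toSet, g y with hm
  have hv0 : volume.real Q.toSet ≠ 0 :=
    (ENNReal.toReal_pos Q.volume_toSet_ne_zero Q.volume_toSet_ne_top).ne'
  have hmean : ‖c - m‖ₑ * volume Q.toSet ≤ ∫⁻ x in Q.toSet, ‖g x - c‖ₑ := by
    have h1 : ∫ x in Q.toSet, (g x - c) = volume.real Q.toSet * (m - c) := by
      rw [integral_sub hgi (integrable_const c), setIntegral_const, hm, setAverage_eq]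
      simp only [smul_eq_mul]
      field_simp
    refine le_trans (le_of_eq ?_) (enorm_integral_le_lintegral_enorm fun x => g x - c)
    rw [h1, enorm_mul, mul_comm, ← enorm_neg (m - c), neg_sub, Real.enorm_eq_ofReal
      measureReal_nonneg, Measure.real, ENNReal.ofReal_toReal Q.volume_toSet_ne_top]
  calc osc g Q * volume Q.toSet = ∫⁻ x in Q.toSet, ‖g x - m‖ₑ := avgAbs_mul_volume _ Q
    _ ≤ ∫⁻ x in Q.toSet, (‖g x - c‖ₑ + ‖c - m‖ₑ) := by
        refine lintegral_mono fun x => ?_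
        rw [← sub_add_sub_cancel (g x) c m]
        exact enorm_add_le _ _
    _ = (∫⁻ x in Q.toSet, ‖g x - c‖ₑ) + ‖c - m‖ₑ * volume Q.toSet := by
        rw [lintegral_add_right _ measurable_const, setLIntegral_const]
    _ ≤ _ := by rw [two_mul]; exact add_le_add le_rfl hmean

lemma mass_ne_zero {v : Space d → ℝ} (hvm : AEMeasurable v volume) (hv : ∀ᵐ x, 0 < v x)
    (Q : Cube d) : mass v Q.toSet ≠ 0 := by
  intro h
  rw [mass, lintegral_eq_zero_iff' hvm.restrict.ennreal_ofReal] at h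
  have : ∀ᵐ x ∂volume.restrict Q.toSet, False := by
    filter_upwards [h, ae_restrict_of_ae hv] with x hx hx'
    exact hx'.not_ge (by simpa using hx)
  rw [ae_iff] at this
  exact Q.volume_toSet_ne_zero (by simpa using this)

lemma mass_ne_top {v : Space d → ℝ} (hv : LocallyIntegrable v volume) (Q : Cube d) :
    mass v Q.toSet ≠ ∞ := by
  have hsub : Q.toSet ⊆ Metric.closedBall Q.center (d * Q.side) := fun x hx => by
    rw [Metric.mem_closedBall, dist_eq_norm]
    exact Cube.norm_sub_le hx Q.center_mem
  have hi := (hv.integrableOn_isCompact (isCompact_closedBall Q.center (d * Q.side))).mono_set hsub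
  refine (lt_of_le_of_lt (lintegral_mono fun x => ?_) hi.2).ne
  rw [Real.enorm_eq_ofReal_abs]
  exact ENNReal.ofReal_le_ofReal (le_abs_self _)

lemma lintegral_maximal_le {v : Space d → ℝ} {Q : Cube d} (h0 : mass v Q.toSet ≠ 0)
    (htop : mass v Q.toSet ≠ ∞) :
    ∫⁻ x in Q.toSet, maximal (Q.toSet.indicator v) x ≤ aInftyConst v * mass v Q.toSet := by
  rw [← ENNReal.div_le_iff h0 htop]
  exact le_iSup (f := fun Q : Cube d =>
    (∫⁻ x in Q.toSet, maximal (Q.toSet.indicator v) x) / mass v Q.toSet) Q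

lemma integrable_of_enorm_le {v f : Space d → ℝ} {N : ℝ≥0∞} (hN : N ≠ ∞)
    (hv : LocallyIntegrable v volume) (hf : AEStronglyMeasurable f volume)
    (hfc : HasCompactSupport f) (hfv : ∀ᵐ x, ‖f x‖ₑ ≤ N * ENNReal.ofReal (v x)) :
    Integrable f volume := by
  rw [← integrableOn_iff_integrable_of_support_subset (subset_tsupport f)]
  refine ⟨hf.restrict, ?_⟩
  have hi := hv.integrableOn_isCompact hfc
  calc ∫⁻ x in tsupport f, ‖f x‖ₑ ≤ ∫⁻ x in tsupport f, N * ‖v x‖ₑ := by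
        refine lintegral_mono_ae (ae_restrict_of_ae (hfv.mono fun x hx => hx.trans ?_))
        rw [Real.enorm_eq_ofReal_abs]
        gcongr
        exact le_abs_self _
    _ = N * ∫⁻ x in tsupport f, ‖v x‖ₑ := lintegral_const_mul' _ _ hN
    _ < ∞ := ENNReal.mul_lt_top hN.lt_top hi.2

lemma enorm_le_eLpNorm_mul {w : Space d → ℝ} (hw : ∀ᵐ x, 0 < w x) (f : Space d → ℝ) :
    ∀ᵐ x, ‖f x‖ₑ ≤ eLpNorm (fun x => f x * w x) ∞ volume * ENNReal.ofReal (w x)⁻¹ := by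
  rw [eLpNorm_exponent_top]
  filter_upwards [hw, enorm_ae_le_eLpNormEssSup (fun x => f x * w x) volume] with x hx hfx
  calc ‖f x‖ₑ = ‖f x * w x‖ₑ * ENNReal.ofReal (w x)⁻¹ := by
        rw [← Real.enorm_eq_ofReal (inv_nonneg.2 hx.le), ← enorm_mul,
          mul_inv_cancel_right₀ hx.ne']
    _ ≤ _ := by gcongr

/-- The first estimate, for a function dominated by a multiple of the weight `v`. -/
theorem osc_div_avgAbs_le (hd : 1 ≤ d) {Ω : ℝ≥0 → ℝ≥0} {A : ℝ≥0} {T : Operator d}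
    {K : Space d → Space d → ℝ} (hΩ : IsModulus Ω) (hΩ1 : 0 < Ω 1) (hT : IsWeakType T A)
    (hTK : IsRepresentedBy T K) (hK : IsSmoothKernel Ω K) {v f : Space d → ℝ} {N : ℝ≥0∞}
    (hN : N ≠ ∞) (hvi : LocallyIntegrable v volume) (hv : ∀ᵐ x, 0 < v x)
    (hfv : ∀ᵐ x, ‖f x‖ₑ ≤ N * ENNReal.ofReal (v x)) (hf : Integrable f volume)
    (hfc : HasCompactSupport f) (Q : Cube d) :
    osc (T (hf.toL1 f)) Q / avgAbs v Q ≤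
      (8 * localConst d : ℝ≥0) * ((1 + A / Ω 1 : ℝ≥0) : ℝ≥0∞) *
        ((bConst Ω (fun _ : Space d => 1) + bConst Ω v) * aInftyConst v * N) := by
  have h0 := mass_ne_zero hvi.aestronglyMeasurable.aemeasurable hv
  have htop := mass_ne_top hvi
  choose c hc using fun Q =>
    exists_const_volume_le hd hΩ hΩ1 hT hTK hK hN hv hfv hf hfc Q (h0 Q) (htop Q)
  have h1 := lintegral_sub_le_lintegral_maximal hc Q
  have h2 := osc_mul_volume_le (T (hf.toL1 f)).aestronglyMeasurable (c Q) Q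
  have h3 := lintegral_maximal_le (h0 Q) (htop Q)
  have hvol0 := Q.volume_toSet_ne_zero
  have hvolt := Q.volume_toSet_ne_top
  have havg : avgAbs v Q * volume Q.toSet = mass v Q.toSet := by
    rw [avgAbs_eq_mass_div hv, ENNReal.div_mul_cancel hvol0 hvolt]
  have ha0 : avgAbs v Q ≠ 0 := fun h => h0 Q (by rw [← havg, h, zero_mul])
  have hat : avgAbs v Q ≠ ∞ := by
    rw [avgAbs_eq_mass_div hv]
    exact ENNReal.div_ne_top (htop Q) hvol0
  rw [ENNReal.div_le_iff ha0 hat, ← ENNReal.mul_le_mul_iff_left hvol0 hvolt]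
  -- The factor `8` is `4` from the stopping argument times `2` from replacing `c Q` by the mean.
  refine h2.trans ((mul_le_mul' le_rfl (h1.trans (mul_le_mul' le_rfl h3))).trans (le_of_eq ?_))
  rw [mul_assoc _ (avgAbs v Q), havg]
  push_cast
  ring

/-! ### The `A_1` and Dini bounds for the second estimate. -/

lemma ae_inv_le_essSupOn (v : Space d → ℝ) (P : Cube d) :
    ∀ᵐ x, x ∈ P.toSet → ‖(v x)⁻¹‖ₑ ≤ essSupOn (fun x => (v x)⁻¹) P := by
  rw [← ae_restrict_iff' P.measurableSet_toSet, essSupOn, eLpNorm_exponent_top]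
  exact enorm_ae_le_eLpNormEssSup _ _

/-- The `A_1` condition says `⟨v⟩_P ≤ [v]_{A_1} v(x)` for almost every `x ∈ P`; integrate this over
`Q`. -/
lemma avgAbs_mul_volume_le_of_subset {v : Space d → ℝ} (hv : ∀ᵐ x, 0 < v x) {P Q : Cube d}
    (h : Q.toSet ⊆ P.toSet) (h0 : mass v Q.toSet ≠ 0) :
    avgAbs v P * volume Q.toSet ≤ aOneConst v * mass v Q.toSet := by
  rcases eq_or_ne (aOneConst v) ∞ with htop | htop
  · rw [htop, ENNReal.top_mul h0]
    exact le_top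
  rw [← setLIntegral_const, mass, ← lintegral_const_mul' _ _ htop]
  refine lintegral_mono_ae ?_
  refine (ae_restrict_iff' Q.measurableSet_toSet).2 ?_
  filter_upwards [ae_inv_le_essSupOn v P, hv] with x hx hvx hxQ
  have h1 : avgAbs v P * ‖(v x)⁻¹‖ₑ ≤ aOneConst v :=
    (mul_le_mul' le_rfl (hx (h hxQ))).trans (le_iSup (f := fun Q : Cube d =>
      avgAbs v Q * essSupOn (fun x => (v x)⁻¹) Q) P)
  rw [Real.enorm_eq_ofReal (inv_nonneg.2 hvx.le), ENNReal.ofReal_inv_of_pos hvx,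
    ← div_eq_mul_inv, ENNReal.div_le_iff (by simpa using hvx) ENNReal.ofReal_ne_top] at h1
  exact h1

/-- On `(2^{-k-1}, 2^{-k}]` one has `Ω(2^{-k}) ≤ 2 Ω(t)`, and `dt/t` gives this interval mass at
least `1/2`. -/
lemma tsum_map_two_inv_pow_le {Ω : ℝ≥0 → ℝ≥0} (hΩ : IsModulus Ω) :
    ∑' k : ℕ, (Ω ((2⁻¹ : ℝ) ^ k).toNNReal : ℝ≥0∞) ≤ 4 * diniNorm Ω := by
  let a (k : ℕ) : ℝ := 2⁻¹ ^ k
  have ha0 : ∀ k, 0 < a k := fun k => by positivity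
  have hsucc : ∀ k, a k = 2 * a (k + 1) := fun k => by
    simp only [a, pow_succ]
    ring
  have hanti : Antitone a := antitone_nat_of_succ_le fun k => by
    rw [hsucc k]
    linarith [ha0 (k + 1)]
  have hdisj : Pairwise (Function.onFun Disjoint fun k : ℕ => Ioc (a (k + 1)) (a k)) :=
    hanti.pairwise_disjoint_on_Ioc_succ
  have hpiece : ∀ k, (Ω (a k).toNNReal : ℝ≥0∞) ≤
      4 * ∫⁻ t in Ioc (a (k + 1)) (a k), (Ω t.toNNReal : ℝ≥0∞) / ENNReal.ofReal t := by
    intro k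
    have hk := ENNReal.ofReal_pos.2 (ha0 k)
    have h1 : (Ω (a k).toNNReal : ℝ≥0∞) ≤ 2 * (Ω (a (k + 1)).toNNReal : ℝ≥0∞) := by
      have := hΩ.map_le_natCast_mul 2 (s := a k) (t := a (k + 1)) (by rw [hsucc k]; simp)
      exact_mod_cast this
    have hlen : 2 * ENNReal.ofReal (a k - a (k + 1)) = ENNReal.ofReal (a k) := by
      rw [← ENNReal.ofReal_ofNat, ← ENNReal.ofReal_mul zero_le_two]
      congr 1
      rw [hsucc k]
      ring
    calc (Ω (a k).toNNReal : ℝ≥0∞) ≤ 2 * (Ω (a (k + 1)).toNNReal : ℝ≥0∞) := h1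
      _ = 4 * ((Ω (a (k + 1)).toNNReal : ℝ≥0∞) / ENNReal.ofReal (a k) *
          volume (Ioc (a (k + 1)) (a k))) := by
          rw [Real.volume_Ioc, show (4 : ℝ≥0∞) = 2 * 2 by norm_num, mul_assoc, mul_left_comm 2
            (_ / _), hlen, ENNReal.div_mul_cancel hk.ne' ENNReal.ofReal_ne_top]
      _ ≤ _ := by
          gcongr
          rw [← setLIntegral_const]
          refine setLIntegral_mono' measurableSet_Ioc fun t ht => ?_
          refine ENNReal.div_le_div ?_ (ENNReal.ofReal_le_ofReal ht.2)
          exact_mod_cast hΩ.mono (Real.toNNReal_le_toNNReal ht.1.le)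
  calc ∑' k : ℕ, (Ω (a k).toNNReal : ℝ≥0∞)
      ≤ ∑' k : ℕ, 4 * ∫⁻ t in Ioc (a (k + 1)) (a k),
        (Ω t.toNNReal : ℝ≥0∞) / ENNReal.ofReal t := ENNReal.tsum_le_tsum hpiece
    _ = 4 * ∫⁻ t in ⋃ k, Ioc (a (k + 1)) (a k), (Ω t.toNNReal : ℝ≥0∞) / ENNReal.ofReal t := by
        rw [ENNReal.tsum_mul_left, lintegral_iUnion (fun _ => measurableSet_Ioc) hdisj]
    _ ≤ _ := by
        refine mul_le_mul' le_rfl (lintegral_mono_set (iUnion_subset fun k => ?_))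
        refine Ioc_subset_Ioc (ha0 _).le ?_
        simpa [a] using hanti (Nat.zero_le k)

/-- The cube with the same center as `Q` and `2 ^ (k + 1)` times its side length. -/
def Cube.dilate (Q : Cube d) (k : ℕ) : Cube d where
  corner := WithLp.toLp 2 fun i => Q.center i - 2 ^ k * Q.side
  side := 2 ^ (k + 1) * Q.side
  side_pos := mul_pos (by positivity) Q.side_pos

lemma Cube.mem_dilate {Q : Cube d} {k : ℕ} {x : Space d}
    (h : ‖x - Q.center‖ < 2 ^ k * Q.side) : x ∈ (Q.dilate k).toSet := by
  intro i
  have h1 := (PiLp.norm_apply_le (x - Q.center) i).trans_lt h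
  rw [Real.norm_eq_abs, abs_lt, PiLp.sub_apply] at h1
  simp only [dilate, pow_succ]
  constructor <;> linarith

lemma Cube.subset_dilate (Q : Cube d) (k : ℕ) : Q.toSet ⊆ (Q.dilate k).toSet := by
  intro x hx i
  have h1 := hx i
  have h2 : Q.side ≤ 2 ^ k * Q.side :=
    le_mul_of_one_le_left Q.side_pos.le (one_le_pow₀ one_le_two)
  have := Q.side_pos
  simp only [dilate, center, pow_succ]
  constructor <;> linarith

/-- The inner radius `b` is a quarter of the side of the dilated cube containing the annulus, which
gives `4^d`. The factor `2` comes from `ℓ/|x - c_Q| ≤ 2 · 2^{-k}`. -/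
lemma lintegral_annulus_le {Ω : ℝ≥0 → ℝ≥0} (hΩ : IsModulus Ω) {v : Space d → ℝ}
    (hv : ∀ᵐ x, 0 < v x) (Q : Cube d) (k : ℕ) :
    ∫⁻ x in {x | 2 ^ k * (Q.side / 2) ≤ ‖x - Q.center‖ ∧ ‖x - Q.center‖ < 2 ^ k * Q.side},
      ENNReal.ofReal (v x / ‖x - Q.center‖ ^ d) *
        (Ω (Q.side / ‖x - Q.center‖).toNNReal : ℝ≥0∞) ≤
      2 * 4 ^ d * (Ω ((2⁻¹ : ℝ) ^ k).toNNReal : ℝ≥0∞) * avgAbs v (Q.dilate k) := by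
  have hs := Q.side_pos
  set b : ℝ := 2 ^ k * (Q.side / 2) with hb
  have hb0 : 0 < b := by positivity
  set S := {x : Space d | b ≤ ‖x - Q.center‖ ∧ ‖x - Q.center‖ < 2 ^ k * Q.side} with hS
  have hnorm : Measurable fun x : Space d => ‖x - Q.center‖ := by fun_prop
  have hSm : MeasurableSet S :=
    (measurableSet_le measurable_const hnorm).inter (measurableSet_lt hnorm measurable_const)
  have hpt : ∀ x ∈ S, ENNReal.ofReal (v x / ‖x - Q.center‖ ^ d) *
      (Ω (Q.side / ‖x - Q.center‖).toNNReal : ℝ≥0∞) ≤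
      (ENNReal.ofReal (1 / b ^ d) * (2 * (Ω ((2⁻¹ : ℝ) ^ k).toNNReal : ℝ≥0∞))) *
        ENNReal.ofReal (v x) := by
    rintro x ⟨hx, -⟩
    have hx0 : 0 < ‖x - Q.center‖ := hb0.trans_le hx
    have h1 : (Ω (Q.side / ‖x - Q.center‖).toNNReal : ℝ≥0∞) ≤
        2 * (Ω ((2⁻¹ : ℝ) ^ k).toNNReal : ℝ≥0∞) := by
      have := hΩ.map_le_natCast_mul 2 (s := Q.side / ‖x - Q.center‖) (t := (2⁻¹ : ℝ) ^ k) (by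
        calc Q.side / ‖x - Q.center‖ ≤ Q.side / b := by gcongr
          _ = _ := by rw [hb, inv_pow]; push_cast; field_simp)
      exact_mod_cast this
    have h2 : ENNReal.ofReal (v x / ‖x - Q.center‖ ^ d) ≤
        ENNReal.ofReal (v x) * ENNReal.ofReal (1 / b ^ d) := by
      rw [div_eq_mul_one_div, ENNReal.ofReal_mul' (by positivity)]
      gcongr
    calc _ ≤ (ENNReal.ofReal (v x) * ENNReal.ofReal (1 / b ^ d)) *
          (2 * (Ω ((2⁻¹ : ℝ) ^ k).toNNReal : ℝ≥0∞)) := mul_le_mul' h2 h1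
      _ = _ := by ring
  have hvol : ENNReal.ofReal (1 / b ^ d) = 4 ^ d * (volume (Q.dilate k).toSet)⁻¹ := by
    rw [Cube.volume_toSet, show (Q.dilate k).side = 4 * b by simp only [Cube.dilate, hb]; ring,
      ENNReal.ofReal_mul (by norm_num), mul_pow (ENNReal.ofReal 4), ENNReal.ofReal_ofNat,
      ENNReal.mul_inv (Or.inl (by simp)) (Or.inl (ENNReal.pow_ne_top (by simp))), ← mul_assoc,
      ENNReal.mul_inv_cancel (by simp) (ENNReal.pow_ne_top (by simp)), one_mul, one_div,
      ENNReal.ofReal_inv_of_pos (by positivity), ENNReal.ofReal_pow hb0.le]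
  calc _ ≤ ∫⁻ x in S, (ENNReal.ofReal (1 / b ^ d) *
        (2 * (Ω ((2⁻¹ : ℝ) ^ k).toNNReal : ℝ≥0∞))) * ENNReal.ofReal (v x) :=
        setLIntegral_mono' hSm hpt
    _ ≤ ∫⁻ x in (Q.dilate k).toSet, (ENNReal.ofReal (1 / b ^ d) *
        (2 * (Ω ((2⁻¹ : ℝ) ^ k).toNNReal : ℝ≥0∞))) * ENNReal.ofReal (v x) :=
        lintegral_mono_set fun x hx => Cube.mem_dilate hx.2
    _ = (ENNReal.ofReal (1 / b ^ d) * (2 * (Ω ((2⁻¹ : ℝ) ^ k).toNNReal : ℝ≥0∞))) *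
        mass v (Q.dilate k).toSet :=
        lintegral_const_mul' _ _ (ENNReal.mul_ne_top ENNReal.ofReal_ne_top
          (ENNReal.mul_ne_top (by simp) ENNReal.coe_ne_top))
    _ = _ := by
        rw [hvol, avgAbs_eq_mass_div hv, div_eq_mul_inv]
        ring

lemma volume_mul_tailIntegral_le_diniNorm {Ω : ℝ≥0 → ℝ≥0} (hΩ : IsModulus Ω) {v : Space d → ℝ}
    (hv : ∀ᵐ x, 0 < v x) {Q : Cube d} (h0 : mass v Q.toSet ≠ 0) :
    volume Q.toSet * tailIntegral Ω v Q ≤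
      8 * 4 ^ d * aOneConst v * diniNorm Ω * mass v Q.toSet := by
  have hs := Q.side_pos
  -- Points outside `Q` are at distance at least `ℓ/2` from the center, so the annuli may start at
  -- `k = 0`.
  have hcov : Q.toSetᶜ ⊆ ⋃ k : ℕ,
      {x | 2 ^ k * (Q.side / 2) ≤ ‖x - Q.center‖ ∧ ‖x - Q.center‖ < 2 ^ k * Q.side} := by
    intro x hx
    have h1 := Cube.le_norm_sub_center hx
    obtain ⟨k, hk1, hk2⟩ := exists_nat_pow_near (x := ‖x - Q.center‖ / (Q.side / 2)) (y := 2)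
      (by rwa [le_div_iff₀ (by positivity), one_mul]) one_lt_two
    rw [le_div_iff₀ (by positivity)] at hk1
    rw [div_lt_iff₀ (by positivity), pow_succ] at hk2
    exact mem_iUnion.2 ⟨k, hk1, by linarith⟩
  calc volume Q.toSet * tailIntegral Ω v Q
      ≤ volume Q.toSet * ∑' k : ℕ,
        2 * 4 ^ d * (Ω ((2⁻¹ : ℝ) ^ k).toNNReal : ℝ≥0∞) * avgAbs v (Q.dilate k) := by
        gcongr
        exact (lintegral_mono_set hcov).trans ((lintegral_iUnion_le _ _).trans
          (ENNReal.tsum_le_tsum fun k => lintegral_annulus_le hΩ hv Q k))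
    _ = ∑' k : ℕ, 2 * 4 ^ d * (Ω ((2⁻¹ : ℝ) ^ k).toNNReal : ℝ≥0∞) *
        (avgAbs v (Q.dilate k) * volume Q.toSet) := by
        rw [← ENNReal.tsum_mul_left]
        exact tsum_congr fun k => by ring
    _ ≤ ∑' k : ℕ, 2 * 4 ^ d * (Ω ((2⁻¹ : ℝ) ^ k).toNNReal : ℝ≥0∞) *
        (aOneConst v * mass v Q.toSet) := by
        refine ENNReal.tsum_le_tsum fun k => mul_le_mul' le_rfl ?_
        exact avgAbs_mul_volume_le_of_subset hv (Q.subset_dilate k) h0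
    _ = 2 * 4 ^ d * (∑' k : ℕ, (Ω ((2⁻¹ : ℝ) ^ k).toNNReal : ℝ≥0∞)) *
        (aOneConst v * mass v Q.toSet) := by
        rw [ENNReal.tsum_mul_right, ENNReal.tsum_mul_left]
    _ ≤ 2 * 4 ^ d * (4 * diniNorm Ω) * (aOneConst v * mass v Q.toSet) := by
        gcongr
        exact tsum_map_two_inv_pow_le hΩ
    _ = _ := by ring

lemma bConst_le_aOneConst_mul_diniNorm {Ω : ℝ≥0 → ℝ≥0} (hΩ : IsModulus Ω) {v : Space d → ℝ}
    (hvi : LocallyIntegrable v volume) (hv : ∀ᵐ x, 0 < v x) :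
    bConst Ω v ≤ 8 * 4 ^ d * aOneConst v * diniNorm Ω := by
  refine iSup_le fun Q => ?_
  have h0 := mass_ne_zero hvi.aestronglyMeasurable.aemeasurable hv Q
  rw [← ENNReal.mul_div_right_comm, ENNReal.div_le_iff h0 (mass_ne_top hvi Q)]
  exact volume_mul_tailIntegral_le_diniNorm hΩ hv h0

lemma aOneConst_one_le : aOneConst (fun _ : Space d => 1) ≤ 1 := by
  refine iSup_le fun Q => ?_
  have h1 : avgAbs (fun _ : Space d => 1) Q = 1 := by
    simp [avgAbs, ENNReal.div_self Q.volume_toSet_ne_zero Q.volume_toSet_ne_top]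
  have h2 : essSupOn (fun _ : Space d => (1 : ℝ)⁻¹) Q ≤ 1 := by
    rw [essSupOn, eLpNorm_exponent_top]
    exact eLpNormEssSup_le_of_ae_enorm_bound (by simp)
  rw [h1, one_mul]
  exact h2

lemma one_le_aOneConst {v : Space d → ℝ} (hvi : LocallyIntegrable v volume)
    (hv : ∀ᵐ x, 0 < v x) : 1 ≤ aOneConst v := by
  let Q : Cube d := ⟨0, 1, one_pos⟩
  have h0 := mass_ne_zero hvi.aestronglyMeasurable.aemeasurable hv Q
  have h := avgAbs_mul_volume_le_of_subset hv (Subset.refl Q.toSet) h0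
  rw [avgAbs_eq_mass_div hv, ENNReal.div_mul_cancel Q.volume_toSet_ne_zero
    Q.volume_toSet_ne_top] at h
  exact (ENNReal.mul_le_mul_iff_left h0 (mass_ne_top hvi Q)).1 (by rwa [one_mul])

/-- The same bound applies to the constant weight, and `[1]_{A_1} ≤ 1 ≤ [v]_{A_1}` merges the two
terms. -/
lemma bConst_one_add_bConst_le {Ω : ℝ≥0 → ℝ≥0} (hΩ : IsModulus Ω) {v : Space d → ℝ}
    (hvi : LocallyIntegrable v volume) (hv : ∀ᵐ x, 0 < v x) :
    bConst Ω (fun _ : Space d => 1) + bConst Ω v ≤ 16 * 4 ^ d * aOneConst v * diniNorm Ω := by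
  have h1 := bConst_le_aOneConst_mul_diniNorm hΩ (v := fun _ : Space d => 1)
    (locallyIntegrable_const 1) (Filter.Eventually.of_forall fun _ => one_pos)
  calc bConst Ω (fun _ : Space d => 1) + bConst Ω v
      ≤ 8 * 4 ^ d * aOneConst v * diniNorm Ω + 8 * 4 ^ d * aOneConst v * diniNorm Ω := by
        refine add_le_add (h1.trans ?_) (bConst_le_aOneConst_mul_diniNorm hΩ hvi hv)
        gcongr
        exact aOneConst_one_le.trans (one_le_aOneConst hvi hv)
    _ = _ := by ring

lemma bmoInfty_le_aOneConst_mul_bmoOne {w : Space d → ℝ}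
    (hvi : LocallyIntegrable (fun x => (w x)⁻¹) volume) (hv : ∀ᵐ x, 0 < (w x)⁻¹)
    (g : Space d → ℝ) :
    bmoInfty w g ≤ aOneConst (fun x => (w x)⁻¹) * bmoOne w g := by
  refine iSup_le fun Q => ?_
  have h0 := mass_ne_zero hvi.aestronglyMeasurable.aemeasurable hv Q
  have htop := mass_ne_top hvi Q
  set a := avgAbs (fun x => (w x)⁻¹) Q with ha
  have hadiv : a = mass (fun x => (w x)⁻¹) Q.toSet / volume Q.toSet := avgAbs_eq_mass_div hv Q
  have ha0 : a ≠ 0 := by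
    rw [hadiv]
    exact ENNReal.div_ne_zero.2 ⟨h0, Q.volume_toSet_ne_top⟩
  have hat : a ≠ ∞ := by
    rw [hadiv]
    exact ENNReal.div_ne_top htop Q.volume_toSet_ne_zero
  have h1 : a * essSupOn w Q ≤ aOneConst (fun x => (w x)⁻¹) := by
    have := le_iSup (f := fun Q : Cube d => avgAbs (fun x => (w x)⁻¹) Q *
      essSupOn (fun x => ((w x)⁻¹)⁻¹) Q) Q
    simp only [inv_inv] at this
    simpa only [aOneConst, inv_inv] using this
  have h2 : osc g Q / a ≤ bmoOne w g :=
    le_iSup (f := fun Q : Cube d => osc g Q / avgAbs (fun x => (w x)⁻¹) Q) Q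
  calc essSupOn w Q * osc g Q = essSupOn w Q * (osc g Q / a * a) := by
        rw [ENNReal.div_mul_cancel ha0 hat]
    _ = a * essSupOn w Q * (osc g Q / a) := by ring
    _ ≤ _ := mul_le_mul' h1 h2

end WeightedBMO

end

theorem theorem4p6 (d : ℕ) (hd : 1 ≤ d) :
    ∃ C : ℝ≥0, ∀ (Ω : ℝ≥0 → ℝ≥0) (A : ℝ≥0) (T : WeightedBMO.Operator d)
      (K : WeightedBMO.Space d → WeightedBMO.Space d → ℝ),
      WeightedBMO.IsModulus Ω → 0 < Ω 1 →
      WeightedBMO.IsWeakType T A →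
      WeightedBMO.IsRepresentedBy T K →
      WeightedBMO.IsSmoothKernel Ω K →
      ∀ w : WeightedBMO.Space d → ℝ, WeightedBMO.IsWeight w →
        LocallyIntegrable (fun x => (w x)⁻¹) volume →
        ∀ f : WeightedBMO.Space d → ℝ, AEStronglyMeasurable f volume →
          HasCompactSupport f →
          eLpNorm (fun x => f x * w x) ∞ volume < ∞ →
          ∃ hf : Integrable f volume,
            WeightedBMO.bmoOne w (T (hf.toL1 f)) ≤
              C * ((1 + A / Ω 1 : ℝ≥0) : ℝ≥0∞) *
                ((WeightedBMO.bConst Ω (fun _ : WeightedBMO.Space d => 1)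
                    + WeightedBMO.bConst Ω (fun x => (w x)⁻¹)) *
                  WeightedBMO.aInftyConst (fun x => (w x)⁻¹) *
                  eLpNorm (fun x => f x * w x) ∞ volume) ∧
            WeightedBMO.bmoInfty w (T (hf.toL1 f)) ≤
              C * ((1 + A / Ω 1 : ℝ≥0) : ℝ≥0∞) *
                (WeightedBMO.aOneConst (fun x => (w x)⁻¹) ^ 2 *
                  WeightedBMO.aInftyConst (fun x => (w x)⁻¹) *
                  WeightedBMO.diniNorm Ω *
                  eLpNorm (fun x => f x * w x) ∞ volume) := by
  -- The factor `16 * 4 ^ d` is needed only in the second estimate; being at least `1`, it is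
  -- harmless in the first.
  refine ⟨8 * WeightedBMO.localConst d * (16 * 4 ^ d), ?_⟩
  intro Ω A T K hΩ hΩ1 hT hTK hK w hw hvi f hfm hfc hN
  have hv : ∀ᵐ x, 0 < (w x)⁻¹ := hw.pos.mono fun x hx => inv_pos.2 hx
  have hfv := WeightedBMO.enorm_le_eLpNorm_mul hw.pos f
  have hf := WeightedBMO.integrable_of_enorm_le hN.ne hvi hfm hfc hfv
  have hone : WeightedBMO.bmoOne w (T (hf.toL1 f)) ≤
      (8 * WeightedBMO.localConst d : ℝ≥0) * ((1 + A / Ω 1 : ℝ≥0) : ℝ≥0∞) *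
        ((WeightedBMO.bConst Ω (fun _ : WeightedBMO.Space d => 1)
            + WeightedBMO.bConst Ω (fun x => (w x)⁻¹)) *
          WeightedBMO.aInftyConst (fun x => (w x)⁻¹) *
          eLpNorm (fun x => f x * w x) ∞ volume) :=
    iSup_le fun Q => WeightedBMO.osc_div_avgAbs_le hd hΩ hΩ1 hT hTK hK hN.ne hvi hv hfv hf hfc Q
  refine ⟨hf, hone.trans ?_, ?_⟩
  · refine mul_le_mul' (mul_le_mul' ?_ le_rfl) le_rfl
    rw [ENNReal.coe_le_coe]
    refine le_mul_of_one_le_right bot_le ?_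
    exact one_le_mul (by norm_num) (one_le_pow₀ (by norm_num))
  · refine (WeightedBMO.bmoInfty_le_aOneConst_mul_bmoOne hvi hv _).trans ?_
    refine (mul_le_mul' le_rfl (hone.trans (mul_le_mul' le_rfl (mul_le_mul' (mul_le_mul'
      (WeightedBMO.bConst_one_add_bConst_le hΩ hvi hv) le_rfl) le_rfl)))).trans (le_of_eq ?_)
    push_cast
    ring
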